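/- **Setting.** Let $d,M\ge 1$, let $D\subset\mathbb R^d$ be a bounded open set (e.g. a bounded Lipschitz domain), $f\in L^2(D)$, and let $a_0,\dots,a_M\in L^\infty(D)$ satisfy $\sum_{m=1}^M|a_m(x)|\le a_0(x)-r$ for a.e. $x\in D$, for some $r>0$. Put $\Gamma=[-1,1]$, $\boldsymbol\Gamma=\Gamma^M$, $\mu=\bigotimes_{m=1}^M \frac{dy_m}{2}$, and $a(y)=a_0+\sum_{m=1}^M y_m a_m$ for $y\in\boldsymbol\Gamma$. Let $H^1_0(D)$ be the closure of $C_c^\infty(D)$ in the $H^1$-norm. For every $y\in\boldsymbol\Gamma$ let $u(y)\in H_0^1(D)$ be the weak solution of $-\nabla\cdot(a(y)\nabla u(y))=f$ in $D$, $u(y)=0$ on $\partial D$, i.e. $\int_D a(y)\nabla u(y)\cdot\nabla w\,dx=\int_D f\,w\,dx$ for all $w\in H^1_0(D)$. **Sparse collocation.** Let $(y_{(i)})_{i\ge0}\subset\Gamma$ be pairwise distinct nodes and $\mathrm m:\mathbb N_0\to\mathbb N_0$ strictly increasing with $\mathrm m(0)=0$. Let $\mathcal I_k$ be Lagrange interpolation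 at the nodes $y_{(0)},\dots,y_{(\mathrm m(k))}$, and set $\Delta_0=\mathcal I_0$, $\Delta_k=\mathcal I_k-\mathcal I_{k-1}$ for $k\ge1$. For $\mathbf i\in\mathbb N_0^M$ let $\Delta_{\mathbf i}=\bigotimes_{m=1}^M\Delta_{i_m}$, acting on functions on $\boldsymbol\Gamma$ with values in a Hilbert space, and let $S_\Lambda=\sum_{\mathbf i\in\Lambda}\Delta_{\mathbf i}$ for finite $\Lambda\subset\mathbb N_0^M$. Let $\|\Delta_k\|_\infty$ denote the operator norm of $\Delta_k$ on $C(\Gamma;\mathbb R)$ with the maximum norm. The margin of $\Lambda$ is $\mathcal M(\Lambda)=\{\mathbf k\notin\Lambda:\ \mathbf k-\mathbf e_m\in\Lambda\text{ for some }m\}$, where $\mathbf e_m$ is the $m$-th unit multi-index. The monotone envelope $E_\Lambda(\mathbf k)$ of $\mathbf k\in\mathcal M(\Lambda)$ is the intersection of all $E\subset\mathcal M(\Lambda)$ with $\mathbf k\in E$ and $\Lambda\cup E$ downward closed. **Algorithm.** Fix $p\in[1,\infty]$ and start with $\Lambda_0=\{\mathbf 0\}$. For $n=0,1,2,\dots$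 let $u_n=S_{\Lambda_n}u$ and $$\eta_n(\mathbf k)=\|\Delta_{\mathbf k}(a\nabla u_n)\|_{L^p_\mu(\boldsymbol\Gamma;L^2(D))},\qquad \mathbf k\in\mathcal M(\Lambda_n);$$ choose $\mathbf k_n^*\in\mathcal M(\Lambda_n)$ maximizing $\eta_n$ over $\mathcal M(\Lambda_n)$ (ties are broken arbitrarily) and set $\Lambda_{n+1}=\Lambda_n\cup E_{\Lambda_n}(\mathbf k_n^*)$. **Theorem 4.2** (Convergence of the adaptive algorithm). Assume that there are finite constants $c,\theta\ge0$ with $$\|\Delta_k\|_\infty\le(1+ck)^\theta\qquad\text{for all }k\in\mathbb N_0 .$$ Then $u$ and all $u_n$ belong to $L^p_\mu(\boldsymbol\Gamma;H^1_0(D))$, and $$\lim_{n\to\infty}\|u-u_n\|_{L^p_\mu(\boldsymbol\Gamma;H^1_0(D))}=0 .$$ -/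

import Mathlib

open MeasureTheory Filter Topology
open scoped ENNReal ContDiff

noncomputable section

namespace SparseColl

/-! ### The parameter domain -/

/-- The univariate parameter interval `[-1, 1]`. -/
abbrev I : Type := Set.Icc (-1 : ℝ) 1

/-- The uniform product probability measure `⨂ dy_m / 2` on `[-1, 1]^M`. -/
def unif (M : ℕ) : Measure (Fin M → I) :=
  Measure.pi fun _ => (2⁻¹ : ℝ≥0∞) • Measure.comap (Subtype.val : I → ℝ) volume

/-! ### Function spaces on the physical domain -/

/-- `ℝ^d` with its Euclidean norm. -/
abbrev Space (d : ℕ) : Type := EuclideanSpace ℝ (Fin d)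

/-- `L^∞(D)`. -/
abbrev LInf {d : ℕ} (D : Set (Space d)) : Type := Lp ℝ ∞ (volume.restrict D)

/-- `L²(D)`. -/
abbrev L2 {d : ℕ} (D : Set (Space d)) : Type := Lp ℝ 2 (volume.restrict D)

/-- `L²(D; ℝ^d)`. -/
abbrev L2Vec {d : ℕ} (D : Set (Space d)) : Type := Lp (Space d) 2 (volume.restrict D)

/-- `H¹₀(D)`: the closure of `C_c^∞(D)` with respect to the norm
`(‖v‖²_{L²} + ‖∇v‖²_{L²})^{1/2}`. An element is recorded as the pair `(v, ∇v)`
of the function and its weak gradient. -/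
def H10 {d : ℕ} (D : Set (Space d)) : Submodule ℝ (WithLp 2 (L2 D × L2Vec D)) :=
  (Submodule.span ℝ {w | ∃ φ : Space d → ℝ,
      ContDiff ℝ ∞ φ ∧ HasCompactSupport φ ∧ tsupport φ ⊆ D ∧
      w.fst =ᵐ[volume.restrict D] φ ∧
      w.snd =ᵐ[volume.restrict D] gradient φ}).topologicalClosure

/-- The function in `L²(D)` underlying an element of `H¹₀(D)`. -/
def H10.fn {d : ℕ} {D : Set (Space d)} (v : H10 D) : L2 D :=
  (v : WithLp 2 (L2 D × L2Vec D)).fst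

/-- The weak gradient of an element of `H¹₀(D)`. -/
def H10.grad {d : ℕ} {D : Set (Space d)} (v : H10 D) : L2Vec D :=
  (v : WithLp 2 (L2 D × L2Vec D)).snd

/-! ### The parametric diffusion problem -/

/-- The affine coefficient `a(y) = a₀ + ∑ y_m a_m ∈ L^∞(D)`. -/
def coeff {d M : ℕ} {D : Set (Space d)} (a₀ : LInf D) (a : Fin M → LInf D)
    (y : Fin M → I) : LInf D :=
  a₀ + ∑ m, (y m : ℝ) • a m

/-- Uniform ellipticity with constant `r`: `∑ |a_m| ≤ a₀ - r` almost everywhere in `D`. -/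
def UniformlyElliptic {d M : ℕ} {D : Set (Space d)} (a₀ : LInf D) (a : Fin M → LInf D)
    (r : ℝ) : Prop :=
  ∀ᵐ x ∂(volume.restrict D), ∑ m, |a m x| ≤ a₀ x - r

/-- The flux `b ∇v ∈ L²(D; ℝ^d)` for `b ∈ L^∞(D)`, `v ∈ H¹₀(D)` (pointwise product). -/
def flux {d : ℕ} {D : Set (Space d)} (b : LInf D) (v : H10 D) : L2Vec D :=
  b • H10.grad v

/-- `v ∈ H¹₀(D)` is the weak solution of `-∇·(b ∇v) = f` in `D`, `v = 0` on `∂D`, i.e.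
`∫_D b ∇v · ∇w = ∫_D f w` for all `w ∈ H¹₀(D)`. -/
def IsWeakSolution {d : ℕ} {D : Set (Space d)} (b : LInf D) (f : L2 D) (v : H10 D) : Prop :=
  ∀ w : H10 D, inner ℝ (flux b v) (H10.grad w) = inner ℝ f (H10.fn w)

/-! ### Univariate interpolation and detail operators

`node` is the node sequence `y_(0), y_(1), …` and `g` the growth function;
the `k`-th node set consists of `y_(0), …, y_(g k)`. -/

/-- The Lagrange polynomial attached to `node j` in the `k`-th node set, `j ≤ g k`,
as a continuous function on `[-1, 1]`. -/
def lagr (node : ℕ → I) (g : ℕ → ℕ) (k j : ℕ) : C(I, ℝ) :=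
  (Lagrange.basis (Finset.range (g k + 1)) (fun i => (node i : ℝ)) j).toContinuousMapOn _

/-- The Lagrange interpolation operator `I_k` on `C([-1, 1])`. -/
def interp (node : ℕ → I) (g : ℕ → ℕ) (k : ℕ) : C(I, ℝ) →L[ℝ] C(I, ℝ) :=
  ∑ j ∈ Finset.range (g k + 1),
    (ContinuousMap.evalCLM ℝ (node j)).smulRight (lagr node g k j)

/-- The detail operator: `Δ_0 = I_0` and `Δ_k = I_k - I_{k-1}` for `k ≥ 1`. -/
def detail (node : ℕ → I) (g : ℕ → ℕ) : ℕ → C(I, ℝ) →L[ℝ] C(I, ℝ)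
  | 0 => interp node g 0
  | k + 1 => interp node g (k + 1) - interp node g k

/-- The weights of the detail operator: `Δ_k φ = ∑_{j ≤ g k} φ(y_(j)) detailWeight k j`. -/
def detailWeight (node : ℕ → I) (g : ℕ → ℕ) : ℕ → ℕ → C(I, ℝ)
  | 0, j => lagr node g 0 j
  | k + 1, j => lagr node g (k + 1) j - if j ≤ g k then lagr node g k j else 0

theorem detail_eq_sum (node : ℕ → I) {g : ℕ → ℕ} (hg : StrictMono g) (k : ℕ) (φ : C(I, ℝ)) :
    detail node g k φ
      = ∑ j ∈ Finset.range (g k + 1), φ (node j) • detailWeight node g k j := by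
  cases k with
  | zero => simp [detail, interp, detailWeight]
  | succ k =>
    have h : g k < g (k + 1) := hg (Nat.lt_succ_self k)
    simp only [detail, interp, detailWeight, _root_.sum_apply,
      _root_.sub_apply, ContinuousLinearMap.smulRight_apply,
      ContinuousMap.evalCLM_apply, smul_sub, Finset.sum_sub_distrib]
    congr 1
    have hs : Finset.range (g k + 1) ⊆ Finset.range (g (k + 1) + 1) := by
      intro j hj
      simp only [Finset.mem_range] at *
      omega
    rw [← Finset.sum_subset hs (f := fun j => φ (node j) •
      (if j ≤ g k then lagr node g k j else 0))]
    · refine Finset.sum_congr rfl fun j hj => ?_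
      have : j ≤ g k := by simp only [Finset.mem_range] at hj; omega
      simp [this]
    · intro j _ hj
      have : ¬ j ≤ g k := by simp only [Finset.mem_range] at hj; omega
      simp [this]

/-! ### Tensorized detail operators and sparse grid collocation -/

/-- The tensorized detail operator `Δ_i = Δ_{i_1} ⊗ ⋯ ⊗ Δ_{i_M}`, applied to a vector-valued
function on `[-1, 1]^M`. -/
def tensorDetail {M : ℕ} {H : Type*} [AddCommGroup H] [Module ℝ H]
    (node : ℕ → I) (g : ℕ → ℕ) (i : Fin M → ℕ) (F : (Fin M → I) → H) : (Fin M → I) → H :=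
  fun y => ∑ j ∈ Fintype.piFinset fun m => Finset.range (g (i m) + 1),
    (∏ m, detailWeight node g (i m) (j m) (y m)) • F fun m => node (j m)

/-- `Δ_i` acts on product functions `∏ φ_m(y_m) • h` as the tensor product of the `Δ_{i_m}`. -/
theorem tensorDetail_prod {M : ℕ} {H : Type*} [AddCommGroup H] [Module ℝ H]
    (node : ℕ → I) {g : ℕ → ℕ} (hg : StrictMono g) (i : Fin M → ℕ)
    (φ : Fin M → C(I, ℝ)) (h : H) (y : Fin M → I) :
    tensorDetail node g i (fun z => (∏ m, φ m (z m)) • h) y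
      = (∏ m, detail node g (i m) (φ m) (y m)) • h := by
  simp only [tensorDetail, detail_eq_sum node hg, ContinuousMap.coe_sum, Finset.sum_apply,
    ContinuousMap.coe_smul, Pi.smul_apply, smul_eq_mul, smul_smul, ← Finset.sum_smul,
    ← Finset.prod_mul_distrib]
  rw [Finset.prod_univ_sum]
  simp only [mul_comm]

/-- The sparse grid collocation operator `S_Λ = ∑_{i ∈ Λ} Δ_i`. -/
def sparse {M : ℕ} {H : Type*} [AddCommGroup H] [Module ℝ H]
    (node : ℕ → I) (g : ℕ → ℕ) (Λ : Finset (Fin M → ℕ)) (F : (Fin M → I) → H) :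
    (Fin M → I) → H :=
  ∑ i ∈ Λ, tensorDetail node g i F

/-! ### Multi-index sets -/

/-- The margin of `Λ`: all `k ∉ Λ` with `k - e_m ∈ Λ` for some `m`. -/
def margin {M : ℕ} (Λ : Set (Fin M → ℕ)) : Set (Fin M → ℕ) :=
  {k | k ∉ Λ ∧ ∃ m, ∃ i ∈ Λ, k = i + Pi.single m 1}

/-- The monotone envelope of `k` with respect to `Λ`: the intersection of all `E ⊆ margin Λ`
containing `k` for which `Λ ∪ E` is downward closed. -/
def envelope {M : ℕ} (Λ : Set (Fin M → ℕ)) (k : Fin M → ℕ) : Set (Fin M → ℕ) :=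
  ⋂₀ {E | E ⊆ margin Λ ∧ k ∈ E ∧ IsLowerSet (Λ ∪ E)}

/-! ### The adaptive algorithm -/

/-- The error estimator `η(k) = ‖Δ_k (a ∇v)‖_{L^p_μ([-1,1]^M; L²(D))}` of `v`. -/
def estimator {d M : ℕ} {D : Set (Space d)} (a₀ : LInf D) (a : Fin M → LInf D)
    (node : ℕ → I) (g : ℕ → ℕ) (p : ℝ≥0∞) (v : (Fin M → I) → H10 D) (k : Fin M → ℕ) : ℝ≥0∞ :=
  eLpNorm (tensorDetail node g k fun y => flux (coeff a₀ a y) (v y)) p (unif M)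

/-- `Λ_0, Λ_1, …` are the index sets produced by the adaptive algorithm for the
parameter-to-solution map `u`: start with `Λ_0 = {0}`; in step `n`, choose a maximizer `k` over
the margin of `Λ_n` (ties broken arbitrarily) of the estimator of `u_n = S_{Λ_n} u`, and add the
monotone envelope of `k`. -/
structure IsAdaptiveRun {d M : ℕ} {D : Set (Space d)} (a₀ : LInf D) (a : Fin M → LInf D)
    (node : ℕ → I) (g : ℕ → ℕ) (p : ℝ≥0∞) (u : (Fin M → I) → H10 D)
    (Λ : ℕ → Finset (Fin M → ℕ)) : Prop where
  init : Λ 0 = {0}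
  step : ∀ n, ∃ k ∈ margin (Λ n : Set (Fin M → ℕ)),
    (∀ i ∈ margin (Λ n : Set (Fin M → ℕ)),
      estimator a₀ a node g p (sparse node g (Λ n) u) i
        ≤ estimator a₀ a node g p (sparse node g (Λ n) u) k) ∧
    (Λ (n + 1) : Set (Fin M → ℕ)) = (Λ n : Set (Fin M → ℕ)) ∪ envelope (Λ n : Set (Fin M → ℕ)) k

end SparseColl

end

noncomputable section

namespace SparseColl

/-! ### Univariate interpolation -/

/-! Two facts are combined: the details of `u` decay summably, and a maximal estimator tending to
zero forces the limit of the algorithm to solve the equation at every node.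

Decay: the Neumann series around `a₀` writes `u` as a sum of polynomials in `y` of total degree at
most `n` with norm at most `C * q ^ n`, `q < 1` (`exists_polynomial_expansion`). Since `Δ_i` kills
every such term with `n < ∑ i_m` and its norm grows only algebraically in `i`, the bounds on `Δ_i u`
are summable, even with algebraic weights (`exists_summable_bound_tensorDetail`).

Algorithm: the affine coefficient raises the degree in one coordinate by one, so `Δ_k (a∇Δ_i u)` can
be nonzero only if `k ≤ i` or `k ≤ i + e_m`. Hence the estimator at `k` is bounded by a tail of a
convergent series, uniformly in the current index set. The selected indices are pairwise distinct,
so the maximal estimators tend to zero, and with them the estimator at each fixed index that is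
never added.

Identification: let `S` be the union of the `Λ n` and `v` the sum of `Δ_i u` over `S`. For `k ∉ S`
the limit gives `Δ_k (a∇v) = 0`; for `k ∈ S`, `v` agrees with `u` on the grid of `k`. Either way
`Δ_k` of the weak residual vanishes, so the residual is zero at all tuples of nodes, and unique
solvability gives `v = u` there. As `Δ_k` only samples nodes, `Δ_k u = Δ_k v = 0` off `S`, whence
the error is a tail of the series over `S`. Density of the nodes plays no role. -/

/-- A polynomial as a continuous function on `[-1, 1]`. -/
def polyFn (P : Polynomial ℝ) : C(I, ℝ) := P.toContinuousMapOn _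

@[simp] theorem polyFn_apply (P : Polynomial ℝ) (y : I) : polyFn P y = P.eval (y : ℝ) := rfl

theorem injOn_coe_node {node : ℕ → I} (hnode : Function.Injective node) (s : Set ℕ) :
    Set.InjOn (fun i => (node i : ℝ)) s :=
  (Subtype.val_injective.comp hnode).injOn

theorem interp_eq_polyFn (node : ℕ → I) (g : ℕ → ℕ) (k : ℕ) (φ : C(I, ℝ)) :
    interp node g k φ = polyFn (Lagrange.interpolate (Finset.range (g k + 1))
      (fun i => (node i : ℝ)) fun i => φ (node i)) := by
  ext y
  simp [interp, lagr, Lagrange.interpolate_apply, Polynomial.eval_finsetSum]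

variable {node : ℕ → I} {g : ℕ → ℕ}

theorem interp_apply_node (hnode : Function.Injective node) {k i : ℕ} (hi : i ≤ g k)
    (φ : C(I, ℝ)) : interp node g k φ (node i) = φ (node i) := by
  rw [interp_eq_polyFn, polyFn_apply]
  exact Lagrange.eval_interpolate_at_node (v := fun i => (node i : ℝ)) _
    (injOn_coe_node hnode _) (by simpa using Nat.lt_succ_of_le hi)

theorem interp_polyFn (hnode : Function.Injective node) {k : ℕ} {P : Polynomial ℝ}
    (hP : P.natDegree ≤ g k) : interp node g k (polyFn P) = polyFn P := by
  rw [interp_eq_polyFn]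
  congr 1
  refine (Lagrange.eq_interpolate (v := fun i => (node i : ℝ)) (injOn_coe_node hnode _) ?_).symm
  rw [Finset.card_range]
  exact Polynomial.degree_le_natDegree.trans_lt (by exact_mod_cast Nat.lt_succ_of_le hP)

/-- Both interpolants in `Δ_{k+1}` are exact at the old nodes. The dual fact, exactness on
polynomials of degree at most `g k`, follows in `detail_polyFn`; all cancellations below reduce to
these two. -/
theorem detail_apply_node (hnode : Function.Injective node) (hg : StrictMono g) {k i : ℕ}
    (hi : i ≤ g k) (φ : C(I, ℝ)) : detail node g (k + 1) φ (node i) = 0 := by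
  simp [detail, interp_apply_node hnode hi,
    interp_apply_node hnode (hi.trans (hg (Nat.lt_succ_self k)).le)]

theorem detail_polyFn (hnode : Function.Injective node) (hg : StrictMono g) {k : ℕ}
    {P : Polynomial ℝ} (hP : P.natDegree ≤ g k) : detail node g (k + 1) (polyFn P) = 0 := by
  simp [detail, interp_polyFn hnode hP,
    interp_polyFn hnode (hP.trans (hg (Nat.lt_succ_self k)).le)]

theorem sum_detail (node : ℕ → I) (g : ℕ → ℕ) (k : ℕ) :
    ∑ i ∈ Finset.range (k + 1), detail node g i = interp node g k := by
  induction k with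
  | zero => simp [detail]
  | succ k ih => rw [Finset.sum_range_succ, ih, detail]; abel

theorem exists_detailWeight_eq_polyFn (hnode : Function.Injective node) (hg : StrictMono g)
    {k j : ℕ} (hj : j ≤ g k) :
    ∃ P : Polynomial ℝ, P.natDegree ≤ g k ∧ detailWeight node g k j = polyFn P := by
  have key : ∀ l, j ≤ g l → ∃ P : Polynomial ℝ, P.natDegree ≤ g l ∧ lagr node g l j = polyFn P := by
    intro l hl
    refine ⟨_, ?_, rfl⟩
    rw [Lagrange.natDegree_basis (injOn_coe_node hnode _) (by simpa using Nat.lt_succ_of_le hl)]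
    simp
  cases k with
  | zero => exact key 0 hj
  | succ k =>
    obtain ⟨P, hP, hPe⟩ := key _ hj
    by_cases h : j ≤ g k
    · obtain ⟨Q, hQ, hQe⟩ := key _ h
      refine ⟨P - Q, (Polynomial.natDegree_sub_le_of_le hP
        (hQ.trans (hg (Nat.lt_succ_self k)).le)).trans_eq (max_self _), ?_⟩
      ext y
      simp [detailWeight, h, hPe, hQe]
    · exact ⟨P, hP, by simp [detailWeight, h, hPe]⟩

theorem exists_polynomial_eval_node (hnode : Function.Injective node) (N : ℕ) (r : ℕ → ℝ) :
    ∃ P : Polynomial ℝ, ∀ j ≤ N, P.eval (node j : ℝ) = r j :=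
  ⟨Lagrange.interpolate (Finset.range (N + 1)) (fun i => (node i : ℝ)) r, fun j hj =>
    Lagrange.eval_interpolate_at_node (v := fun i => (node i : ℝ)) _
      (injOn_coe_node hnode _) (by simpa using Nat.lt_succ_of_le hj)⟩

/-- The Lebesgue function of the detail operator is bounded by its operator norm. -/
theorem sum_abs_detailWeight_le (hnode : Function.Injective node) (hg : StrictMono g) (k : ℕ)
    (y : I) :
    ∑ j ∈ Finset.range (g k + 1), |detailWeight node g k j y| ≤ ‖detail node g k‖ := by
  -- The extremal test function takes the signs of the weights at the nodes: interpolate them by a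
  -- polynomial, then clip it to `[-1, 1]`, which keeps the nodal values and makes the norm at most
  -- one.
  obtain ⟨P, hP⟩ := exists_polynomial_eval_node hnode (g k)
    fun j => ((SignType.sign (detailWeight node g k j y) : SignType) : ℝ)
  let φ : C(I, ℝ) := ⟨fun z => max (-1) (min 1 (polyFn P z)), by fun_prop⟩
  have hφ : ‖φ‖ ≤ 1 := (ContinuousMap.norm_le _ zero_le_one).2 fun z => by
    rw [Real.norm_eq_abs, abs_le]
    exact ⟨le_max_left _ _, max_le (by norm_num) (min_le_left _ _)⟩
  have hφn : ∀ j ≤ g k, φ (node j) = (SignType.sign (detailWeight node g k j y) : SignType) := by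
    intro j hj
    simp only [φ, ContinuousMap.coe_mk, polyFn_apply, hP j hj]
    rcases SignType.sign (detailWeight node g k j y) with _ | _ | _ <;> norm_num
  calc ∑ j ∈ Finset.range (g k + 1), |detailWeight node g k j y|
      = detail node g k φ y := by
        rw [detail_eq_sum node hg, ContinuousMap.coe_sum, Finset.sum_apply]
        refine Finset.sum_congr rfl fun j hj => ?_
        rw [ContinuousMap.smul_apply, smul_eq_mul,
          hφn j (Nat.lt_succ_iff.1 (Finset.mem_range.1 hj)), sign_mul_self]
    _ ≤ ‖detail node g k φ‖ := (le_abs_self _).trans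
        (ContinuousMap.norm_coe_le_norm (detail node g k φ) y)
    _ ≤ ‖detail node g k‖ * ‖φ‖ := ContinuousLinearMap.le_opNorm _ _
    _ ≤ ‖detail node g k‖ := mul_le_of_le_one_right (ContinuousLinearMap.opNorm_nonneg _) hφ

/-! ### Tensorized detail operators -/

section Tensor

variable {M : ℕ} {H H' : Type*} [NormedAddCommGroup H] [NormedSpace ℝ H]
  [NormedAddCommGroup H'] [NormedSpace ℝ H'] {node : ℕ → I} {g : ℕ → ℕ}

/-- The span of the functions `y ↦ ∏ P_m(y_m) • h` with polynomials `P_m` of degree at most `ν_m`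
for some `ν ∈ S`. -/
def polySpan (S : Set (Fin M → ℕ)) (H : Type*) [NormedAddCommGroup H] [NormedSpace ℝ H] :
    Submodule ℝ ((Fin M → I) → H) :=
  Submodule.span ℝ {F | ∃ ν ∈ S, ∃ P : Fin M → Polynomial ℝ, (∀ m, (P m).natDegree ≤ ν m) ∧
    ∃ h : H, F = fun y => (∏ m, polyFn (P m) (y m)) • h}

theorem prod_polyFn_smul_mem_polySpan {S : Set (Fin M → ℕ)} {ν : Fin M → ℕ} (hν : ν ∈ S)
    {P : Fin M → Polynomial ℝ} (hP : ∀ m, (P m).natDegree ≤ ν m) (h : H) :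
    (fun y => (∏ m, polyFn (P m) (y m)) • h) ∈ polySpan S H :=
  Submodule.subset_span ⟨ν, hν, P, hP, h, rfl⟩

theorem const_mem_polySpan {S : Set (Fin M → ℕ)} (hS : 0 ∈ S) (h : H) :
    (fun _ => h) ∈ polySpan S H := by
  simpa using prod_polyFn_smul_mem_polySpan hS (P := fun _ => 1) (fun m => by simp) h

theorem coord_smul_mem_polySpan {S T : Set (Fin M → ℕ)} (m : Fin M)
    (hST : ∀ ν ∈ S, ν + Pi.single m 1 ∈ T) {F : (Fin M → I) → H} (hF : F ∈ polySpan S H) :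
    (fun y => (y m : ℝ) • F y) ∈ polySpan T H := by
  induction hF using Submodule.span_induction with
  | mem F hF =>
    obtain ⟨ν, hν, P, hP, h, rfl⟩ := hF
    -- The coordinate is absorbed into the `m`-th univariate factor.
    convert prod_polyFn_smul_mem_polySpan (hST ν hν)
      (P := fun l => P l * if l = m then Polynomial.X else 1) (fun l => ?_) h using 2 with y
    · simp only [polyFn_apply, Polynomial.eval_mul, Finset.prod_mul_distrib, smul_smul]
      rw [mul_comm, Finset.prod_eq_single (M := ℝ) m (f := fun l =>
        Polynomial.eval (y l : ℝ) (if l = m then Polynomial.X else 1))] <;> simp +contextual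
    · refine Polynomial.natDegree_mul_le.trans (add_le_add (hP l) ?_)
      by_cases h : l = m
      · subst h; simp
      · simp [h]
  | zero =>
    simp only [Pi.zero_apply, smul_zero]
    exact zero_mem _
  | add F G _ _ hF hG =>
    simp only [Pi.add_apply, smul_add]
    exact add_mem hF hG
  | smul c F _ hF =>
    simp only [Pi.smul_apply, fun y : Fin M → I => smul_comm (y m : ℝ) c (F y)]
    exact Submodule.smul_mem _ c hF

theorem map_mem_polySpan {S : Set (Fin M → ℕ)} (L : H →ₗ[ℝ] H') {F : (Fin M → I) → H}
    (hF : F ∈ polySpan S H) : (fun y => L (F y)) ∈ polySpan S H' := by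
  induction hF using Submodule.span_induction with
  | mem F hF =>
    obtain ⟨ν, hν, P, hP, h, rfl⟩ := hF
    simpa using prod_polyFn_smul_mem_polySpan hν hP (L h)
  | zero =>
    simp only [Pi.zero_apply, map_zero]
    exact zero_mem _
  | add F G _ _ hF hG =>
    simp only [Pi.add_apply, map_add]
    exact add_mem hF hG
  | smul c F _ hF =>
    simp only [Pi.smul_apply, map_smul]
    exact Submodule.smul_mem _ c hF

theorem continuous_of_mem_polySpan {S : Set (Fin M → ℕ)} {F : (Fin M → I) → H}
    (hF : F ∈ polySpan S H) : Continuous F := by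
  induction hF using Submodule.span_induction with
  | mem F hF =>
    obtain ⟨ν, hν, P, hP, h, rfl⟩ := hF
    fun_prop
  | zero => exact continuous_const
  | add F G _ _ hF hG => exact hF.add hG
  | smul c F _ hF => exact hF.const_smul c

/-- The operator `Δ_i` as a linear map. -/
def tensorDetailₗ (node : ℕ → I) (g : ℕ → ℕ) (i : Fin M → ℕ) :
    ((Fin M → I) → H) →ₗ[ℝ] ((Fin M → I) → H) where
  toFun := tensorDetail node g i
  map_add' F G := by
    ext y
    simp [tensorDetail, Finset.sum_add_distrib]
  map_smul' c F := by
    ext y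
    simp [tensorDetail, Finset.smul_sum, smul_comm c]

theorem tensorDetailₗ_apply (i : Fin M → ℕ) (F : (Fin M → I) → H) :
    tensorDetailₗ node g i F = tensorDetail node g i F := rfl

theorem tensorDetail_comp (i : Fin M → ℕ) (L : H →ₗ[ℝ] H') (F : (Fin M → I) → H) (y : Fin M → I) :
    tensorDetail node g i (fun z => L (F z)) y = L (tensorDetail node g i F y) := by
  simp [tensorDetail]

theorem tensorDetail_congr {i : Fin M → ℕ} {F G : (Fin M → I) → H}
    (h : ∀ j : Fin M → ℕ, (∀ m, j m ≤ g (i m)) → F (fun m => node (j m)) = G fun m => node (j m)) :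
    tensorDetail node g i F = tensorDetail node g i G := by
  ext y
  refine Finset.sum_congr rfl fun j hj => ?_
  rw [h j fun m => Nat.lt_succ_iff.1 (Finset.mem_range.1 (Fintype.mem_piFinset.1 hj m))]

theorem tensorDetail_zero (i : Fin M → ℕ) :
    tensorDetail node g i (0 : (Fin M → I) → H) = 0 :=
  (tensorDetailₗ (H := H) node g i).map_zero

theorem tensorDetail_mem_polySpan (hnode : Function.Injective node) (hg : StrictMono g)
    (i : Fin M → ℕ) (F : (Fin M → I) → H) :
    tensorDetail node g i F ∈ polySpan {fun m => g (i m)} H := by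
  have : tensorDetail node g i F = ∑ j ∈ Fintype.piFinset fun m => Finset.range (g (i m) + 1),
      fun y => (∏ m, detailWeight node g (i m) (j m) (y m)) • F fun m => node (j m) := by
    ext y
    simp [tensorDetail]
  rw [this]
  refine Submodule.sum_mem _ fun j hj => ?_
  choose P hP hPe using fun m => exists_detailWeight_eq_polyFn hnode hg
    (Nat.lt_succ_iff.1 (Finset.mem_range.1 (Fintype.mem_piFinset.1 hj m)))
  simp only [hPe]
  exact prod_polyFn_smul_mem_polySpan (Set.mem_singleton _) hP (F fun m => node (j m))

/-- A product function is killed as soon as one univariate factor is. Writing `i m = k + 1`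
expresses that the degree must be resolved by the previous level in that direction. -/
theorem tensorDetail_eq_zero_of_mem_polySpan (hnode : Function.Injective node)
    (hg : StrictMono g) {i : Fin M → ℕ} {S : Set (Fin M → ℕ)}
    (hS : ∀ ν ∈ S, ∃ m k, i m = k + 1 ∧ ν m ≤ g k) {F : (Fin M → I) → H}
    (hF : F ∈ polySpan S H) : tensorDetail node g i F = 0 := by
  suffices polySpan S H ≤ LinearMap.ker (tensorDetailₗ (H := H) node g i) from this hF
  refine Submodule.span_le.2 ?_
  rintro _ ⟨ν, hν, P, hP, h, rfl⟩
  obtain ⟨m, k, hik, hk⟩ := hS ν hν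
  rw [SetLike.mem_coe, LinearMap.mem_ker, tensorDetailₗ_apply]
  ext1 y
  rw [tensorDetail_prod node hg, Finset.prod_eq_zero (Finset.mem_univ m)]
  · simp
  · rw [hik, detail_polyFn hnode hg ((hP m).trans hk)]
    rfl

/-- Tensor Lagrange interpolation. Since `Δ_i F` depends only on nodal values, this reduces
identities for arbitrary `F`, without any regularity, to product functions. -/
theorem exists_polySpan_eq_on_nodes (hnode : Function.Injective node) (N : ℕ)
    (F : (Fin M → I) → H) : ∃ G ∈ polySpan Set.univ H, ∀ j : Fin M → ℕ, (∀ m, j m ≤ N) →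
      G (fun m => node (j m)) = F fun m => node (j m) := by
  choose P hP using fun i => exists_polynomial_eval_node hnode N fun j => if i = j then 1 else 0
  refine ⟨∑ i ∈ Fintype.piFinset fun _ : Fin M => Finset.range (N + 1),
    fun y => (∏ m, polyFn (P (i m)) (y m)) • F fun m => node (i m),
    Submodule.sum_mem _ fun i _ => prod_polyFn_smul_mem_polySpan (Set.mem_univ _)
      (fun m => le_rfl) _, fun j hj => ?_⟩
  rw [Finset.sum_apply, Finset.sum_eq_single j]
  · simp [hP _ _ (hj _)]
  · intro i _ hij
    obtain ⟨m, hm⟩ := Function.ne_iff.1 hij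
    rw [Finset.prod_eq_zero (Finset.mem_univ m), zero_smul]
    simp [hP _ _ (hj m), hm]
  · intro h
    exact absurd (Fintype.mem_piFinset.2 fun m => Finset.mem_range.2 (Nat.lt_succ_of_le (hj m))) h

theorem tensorDetail_apply_node (hnode : Function.Injective node) (hg : StrictMono g)
    {i j : Fin M → ℕ} (hij : ∃ m k, i m = k + 1 ∧ j m ≤ g k) (F : (Fin M → I) → H) :
    tensorDetail node g i F (fun m => node (j m)) = 0 := by
  obtain ⟨G, hG, hGF⟩ := exists_polySpan_eq_on_nodes hnode (∑ m, g (i m)) F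
  rw [tensorDetail_congr fun j hj => (hGF j fun m => (hj m).trans
    (Finset.single_le_sum (f := fun m => g (i m)) (fun _ _ => Nat.zero_le _)
      (Finset.mem_univ m))).symm]
  suffices polySpan Set.univ H ≤
    LinearMap.ker ((LinearMap.proj (R := ℝ) (φ := fun _ => H) fun m => node (j m)).comp
      (tensorDetailₗ (H := H) node g i)) from this hG
  refine Submodule.span_le.2 ?_
  rintro _ ⟨ν, hν, P, hP, h, rfl⟩
  obtain ⟨m, k, hik, hk⟩ := hij
  rw [SetLike.mem_coe, LinearMap.mem_ker, LinearMap.comp_apply, LinearMap.proj_apply,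
    tensorDetailₗ_apply, tensorDetail_prod node hg, Finset.prod_eq_zero (Finset.mem_univ m),
    zero_smul]
  rw [hik, detail_apply_node hnode hg hk]

/-- On a box the sum factorizes into univariate sums, each of which telescopes to `I_{k_m}`. -/
theorem sum_tensorDetail_prod (hg : StrictMono g) (k : Fin M → ℕ) (φ : Fin M → C(I, ℝ)) (h : H)
    (y : Fin M → I) :
    ∑ i ∈ Fintype.piFinset fun m => Finset.range (k m + 1),
      tensorDetail node g i (fun z => (∏ m, φ m (z m)) • h) y
      = (∏ m, interp node g (k m) (φ m) (y m)) • h := by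
  simp only [tensorDetail_prod node hg, ← Finset.sum_smul]
  rw [← Finset.prod_univ_sum (t := fun m => Finset.range (k m + 1))
    (f := fun m i => detail node g i (φ m) (y m))]
  simp only [← sum_detail, _root_.sum_apply, ContinuousMap.coe_sum, Finset.sum_apply]

/-- Sparse grid collocation on a downward closed set interpolates at the sparse grid. -/
theorem sparse_apply_node (hnode : Function.Injective node) (hg : StrictMono g)
    {Λ : Finset (Fin M → ℕ)} (hΛ : IsLowerSet (Λ : Set (Fin M → ℕ))) {k j : Fin M → ℕ}
    (hk : k ∈ Λ) (hj : ∀ m, j m ≤ g (k m)) (F : (Fin M → I) → H) :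
    sparse node g Λ F (fun m => node (j m)) = F fun m => node (j m) := by
  obtain ⟨G, hG, hGF⟩ := exists_polySpan_eq_on_nodes hnode (∑ i ∈ Λ, ∑ m, g (i m)) F
  have hN : ∀ i ∈ Λ, ∀ m, g (i m) ≤ ∑ i ∈ Λ, ∑ m, g (i m) := fun i hi m =>
    (Finset.single_le_sum (f := fun m => g (i m)) (fun _ _ => Nat.zero_le _)
      (Finset.mem_univ m)).trans
    (Finset.single_le_sum (f := fun i => ∑ m, g (i m)) (fun _ _ => Nat.zero_le _) hi)
  rw [← hGF j fun m => (hj m).trans (hN k hk m)]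
  have : sparse node g Λ F = sparse node g Λ G :=
    Finset.sum_congr rfl fun i hi => tensorDetail_congr fun j hj =>
      (hGF j fun m => (hj m).trans (hN i hi m)).symm
  rw [this, ← sub_eq_zero]
  suffices polySpan Set.univ H ≤
    LinearMap.ker ((LinearMap.proj (R := ℝ) (φ := fun _ => H) fun m => node (j m)).comp
      (∑ i ∈ Λ, tensorDetailₗ (H := H) node g i - LinearMap.id)) by
    simpa [tensorDetailₗ_apply, sparse] using this hG
  refine Submodule.span_le.2 ?_
  rintro _ ⟨ν, hν, P, hP, h, rfl⟩
  simp only [SetLike.mem_coe, LinearMap.mem_ker, LinearMap.comp_apply, LinearMap.sub_apply,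
    LinearMap.sum_apply, tensorDetailₗ_apply, LinearMap.id_apply, LinearMap.proj_apply,
    Pi.sub_apply, Finset.sum_apply, sub_eq_zero]
  -- Only the box below `k` contributes at this node: outside it some `i m > k m`, and that detail
  -- vanishes at nodes of level `k m`.
  rw [← Finset.sum_subset (s₁ := Fintype.piFinset fun m => Finset.range (k m + 1)),
    sum_tensorDetail_prod hg]
  · simp only [interp_apply_node hnode (hj _)]
  · intro i hi
    exact hΛ (fun m => Nat.lt_succ_iff.1 (Finset.mem_range.1 (Fintype.mem_piFinset.1 hi m))) hk
  · intro i _ hi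
    simp only [Fintype.mem_piFinset, Finset.mem_range, not_forall, not_lt] at hi
    obtain ⟨m, hm⟩ := hi
    refine tensorDetail_apply_node hnode hg ⟨m, i m - 1, by omega, (hj m).trans
      (hg.monotone (by omega))⟩ _

theorem sum_tensorDetail_of_mem_polySpan (hnode : Function.Injective node) (hg : StrictMono g)
    {k : Fin M → ℕ} {S : Set (Fin M → ℕ)} (hS : ∀ ν ∈ S, ∀ m, ν m ≤ g (k m))
    {F : (Fin M → I) → H} (hF : F ∈ polySpan S H) :
    ∑ i ∈ Fintype.piFinset fun m => Finset.range (k m + 1), tensorDetail node g i F = F := by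
  rw [← sub_eq_zero]
  suffices polySpan S H ≤ LinearMap.ker ((∑ i ∈ Fintype.piFinset fun m => Finset.range (k m + 1),
      tensorDetailₗ (H := H) node g i) - LinearMap.id) by
    simpa [tensorDetailₗ_apply] using this hF
  refine Submodule.span_le.2 ?_
  rintro _ ⟨ν, hν, P, hP, h, rfl⟩
  simp only [SetLike.mem_coe, LinearMap.mem_ker, LinearMap.sub_apply, LinearMap.sum_apply,
    tensorDetailₗ_apply, LinearMap.id_apply, sub_eq_zero]
  ext1 y
  rw [Finset.sum_apply, sum_tensorDetail_prod hg]
  simp only [interp_polyFn hnode ((hP _).trans (hS ν hν _))]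

/-- If `i m < k m`, then `Δ_k F` vanishes at every node sampled by `Δ_i`; if `i m > k m`, its degree
in `y m` is too low for `Δ_i`. -/
theorem tensorDetail_tensorDetail_of_ne (hnode : Function.Injective node) (hg : StrictMono g)
    {i k : Fin M → ℕ} (hik : i ≠ k) (F : (Fin M → I) → H) :
    tensorDetail node g i (tensorDetail node g k F) = 0 := by
  obtain ⟨m, hm⟩ := Function.ne_iff.1 hik
  rcases hm.lt_or_gt with h | h
  · refine (tensorDetail_congr fun j hj => ?_).trans (tensorDetail_zero i)
    exact tensorDetail_apply_node hnode hg ⟨m, k m - 1, by omega, (hj m).trans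
      (hg.monotone (by omega))⟩ _
  · refine tensorDetail_eq_zero_of_mem_polySpan hnode hg ?_ (tensorDetail_mem_polySpan hnode hg k F)
    rintro _ rfl
    exact ⟨m, i m - 1, by omega, hg.monotone (by omega)⟩

theorem norm_tensorDetail_le (hnode : Function.Injective node) (hg : StrictMono g)
    (i : Fin M → ℕ) {F : (Fin M → I) → H} {C : ℝ} (hF : ∀ y, ‖F y‖ ≤ C) (y : Fin M → I) :
    ‖tensorDetail node g i F y‖ ≤ (∏ m, ‖detail node g (i m)‖) * C := by
  have hC : 0 ≤ C := (norm_nonneg _).trans (hF y)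
  calc ‖tensorDetail node g i F y‖
      ≤ ∑ j ∈ Fintype.piFinset fun m => Finset.range (g (i m) + 1),
        (∏ m, |detailWeight node g (i m) (j m) (y m)|) * C := by
        refine norm_sum_le_of_le _ fun j _ => ?_
        rw [norm_smul, Real.norm_eq_abs, Finset.abs_prod]
        exact mul_le_mul_of_nonneg_left (hF _) (Finset.prod_nonneg fun _ _ => abs_nonneg _)
    _ = (∏ m, ∑ j ∈ Finset.range (g (i m) + 1), |detailWeight node g (i m) j (y m)|) * C := by
        rw [← Finset.sum_mul, Finset.prod_univ_sum]
    _ ≤ (∏ m, ‖detail node g (i m)‖) * C :=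
        mul_le_mul_of_nonneg_right (Finset.prod_le_prod
          (fun m _ => Finset.sum_nonneg fun _ _ => abs_nonneg _)
          fun m _ => sum_abs_detailWeight_le hnode hg _ _) hC

theorem tendsto_tensorDetail {ι : Type*} {l : Filter ι} (i : Fin M → ℕ)
    {F : ι → (Fin M → I) → H} {G : (Fin M → I) → H}
    (h : ∀ y, Tendsto (fun n => F n y) l (𝓝 (G y))) (y : Fin M → I) :
    Tendsto (fun n => tensorDetail node g i (F n) y) l (𝓝 (tensorDetail node g i G y)) :=
  tendsto_finsetSum _ fun _ _ => (h _).const_smul _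

end Tensor

/-! ### Summability of the detail expansion -/

/-- Any finite index set lies in the box of its projections, over which the sum of products is a
product of sums. -/
theorem summable_prod_comp {M : ℕ} {f : ℕ → ℝ} (hf : ∀ k, 0 ≤ f k) (hs : Summable f) :
    Summable fun i : Fin M → ℕ => ∏ m, f (i m) := by
  refine summable_of_sum_le (c := ∏ _m : Fin M, ∑' k, f k)
    (fun i => Finset.prod_nonneg fun m _ => hf _) fun s => ?_
  have hsub : s ⊆ Fintype.piFinset fun m => s.image fun i => i m := fun i hi =>
    Fintype.mem_piFinset.2 fun m => Finset.mem_image_of_mem _ hi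
  refine (Finset.sum_le_sum_of_subset_of_nonneg hsub
    fun i _ _ => Finset.prod_nonneg fun m _ => hf _).trans ?_
  rw [← Finset.prod_univ_sum (t := fun m => s.image fun i => i m) (f := fun _ k => f k)]
  exact Finset.prod_le_prod (fun m _ => Finset.sum_nonneg fun k _ => hf k)
    fun m _ => hs.sum_le_tsum _ fun k _ => hf k

theorem one_add_mul_rpow_le {c θ : ℝ} (hc : 0 ≤ c) {N : ℕ} (hN : θ ≤ N) (k : ℕ) :
    (1 + c * ((k : ℝ) + 1)) ^ θ ≤ (1 + c) ^ N * (2 ^ N * (k : ℝ) ^ N + 1) := by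
  have hk0 : (0 : ℝ) ≤ k := k.cast_nonneg
  have hk : ((k : ℝ) + 1) ^ N ≤ 2 ^ N * (k : ℝ) ^ N + 1 := by
    rcases Nat.eq_zero_or_pos k with hk | hk
    · rw [hk]
      simp
    · have : (1 : ℝ) ≤ k := by exact_mod_cast hk
      rw [← mul_pow]
      have : ((k : ℝ) + 1) ^ N ≤ (2 * k) ^ N := by gcongr; linarith
      linarith
  calc (1 + c * ((k : ℝ) + 1)) ^ θ ≤ (1 + c * ((k : ℝ) + 1)) ^ (N : ℝ) :=
        Real.rpow_le_rpow_of_exponent_le (by nlinarith) hN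
    _ = (1 + c * ((k : ℝ) + 1)) ^ N := Real.rpow_natCast _ _
    _ ≤ ((1 + c) * ((k : ℝ) + 1)) ^ N := by gcongr; nlinarith
    _ = (1 + c) ^ N * ((k : ℝ) + 1) ^ N := mul_pow _ _ _
    _ ≤ _ := mul_le_mul_of_nonneg_left hk (by positivity)

theorem summable_rpow_mul_geometric {c θ s : ℝ} (hc : 0 ≤ c) (hs0 : 0 ≤ s)
    (hs : s < 1) : Summable fun k : ℕ => (1 + c * (k + 1)) ^ θ * s ^ k := by
  obtain ⟨N, hN⟩ := exists_nat_ge θ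
  have hs' : ‖s‖ < 1 := by rwa [Real.norm_of_nonneg hs0]
  have h1 := (((summable_pow_mul_geometric_of_norm_lt_one N hs').mul_left (2 ^ N)).add
      (summable_geometric_of_lt_one hs0 hs)).mul_left ((1 + c) ^ N)
  refine Summable.of_nonneg_of_le (fun k => by positivity) (fun k => ?_) h1
  refine (mul_le_mul_of_nonneg_right (one_add_mul_rpow_le hc hN k)
    (pow_nonneg hs0 k)).trans_eq ?_
  ring

/-- Only terms with `n ≥ ∑ i_m` survive `Δ_i`, which turns geometric decay in `n` into geometric
decay in `i`. The weight, shifted by one, anticipates the operator norms of `Δ_k` with `k ≤ i + 1`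
needed for the estimator. -/
theorem exists_summable_bound_tensorDetail {M : ℕ} {V : Type*} [NormedAddCommGroup V]
    [NormedSpace ℝ V] [CompleteSpace V] {node : ℕ → I} {g : ℕ → ℕ}
    (hnode : Function.Injective node) (hg : StrictMono g)
    {c θ : ℝ} (hc : 0 ≤ c) (hθ : 0 ≤ θ)
    (hΔ : ∀ k : ℕ, ‖detail node g k‖ ≤ (1 + c * (k : ℝ)) ^ θ)
    {u : (Fin M → I) → V} {v : ℕ → (Fin M → I) → V} {C q : ℝ} (hq0 : 0 ≤ q) (hq : q < 1)
    (hv : ∀ n, v n ∈ polySpan {ν | ∑ m, ν m ≤ n} V) (hvC : ∀ n y, ‖v n y‖ ≤ C * q ^ n)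
    (hvu : ∀ y, HasSum (fun n => v n y) (u y)) :
    ∃ δ : (Fin M → ℕ) → ℝ, (∀ i, 0 ≤ δ i) ∧
      Summable (fun i => (∏ m, (1 + c * ((i m : ℝ) + 1)) ^ θ) * δ i) ∧
      (∀ i y, ‖tensorDetail node g i u y‖ ≤ δ i) ∧
      ∀ y, HasSum (fun i => tensorDetail node g i u y) (u y) := by
  -- As `q ^ n = s ^ n * s ^ n`, one factor pays for the sum over `i` and the other for the sum over
  -- `n`.
  set s := √q with hs
  have hs0 : 0 ≤ s := Real.sqrt_nonneg q
  have hs1 : s < 1 := by rw [hs, Real.sqrt_lt' one_pos]; simpa using hq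
  have hqs : q = s * s := (Real.mul_self_sqrt hq0).symm
  have hC : 0 ≤ C := by simpa using (norm_nonneg _).trans (hvC 0 fun _ => ⟨0, by norm_num⟩)
  let w : (Fin M → ℕ) → ℝ := fun i => ∏ m, ((1 + c * (i m : ℝ)) ^ θ * s ^ i m)
  have hw : ∀ i, 0 ≤ w i := fun i => Finset.prod_nonneg fun m _ => by positivity
  have hzero : ∀ i n, n < ∑ m, i m → tensorDetail node g i (v n) = 0 := fun i n hn => by
    refine tensorDetail_eq_zero_of_mem_polySpan hnode hg (fun ν hν => ?_) (hv n)
    obtain ⟨m, -, hm⟩ := Finset.exists_lt_of_sum_lt (lt_of_le_of_lt hν hn)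
    exact ⟨m, i m - 1, by omega, le_trans (by omega) (hg.le_apply (x := i m - 1))⟩
  have hb : ∀ y i n, ‖tensorDetail node g i (v n) y‖ ≤ w i * (C * s ^ n) := fun y i n => by
    rcases lt_or_ge n (∑ m, i m) with h | h
    · rw [hzero i n h]
      simpa using mul_nonneg (hw i) (by positivity)
    · calc ‖tensorDetail node g i (v n) y‖
          ≤ (∏ m, ‖detail node g (i m)‖) * (C * q ^ n) :=
            norm_tensorDetail_le hnode hg i (hvC n) y
        _ ≤ (∏ m, (1 + c * (i m : ℝ)) ^ θ) * (C * (s ^ (∑ m, i m) * s ^ n)) := by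
            rw [hqs, mul_pow]
            refine mul_le_mul (Finset.prod_le_prod (fun m _ =>
              ContinuousLinearMap.opNorm_nonneg _) fun m _ => hΔ _) ?_ (by positivity)
              (Finset.prod_nonneg fun m _ => by positivity)
            exact mul_le_mul_of_nonneg_left (mul_le_mul_of_nonneg_right
              (pow_le_pow_of_le_one hs0 hs1.le h) (by positivity)) hC
        _ = w i * (C * s ^ n) := by
            simp only [w, Finset.prod_mul_distrib, Finset.prod_pow_eq_pow_sum]
            ring
  have hsum : Summable fun n : ℕ => C * s ^ n := (summable_geometric_of_lt_one hs0 hs1).mul_left C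
  have hgeo : Summable fun i => (∏ m, (1 + c * ((i m : ℝ) + 1)) ^ θ) * w i := by
    refine Summable.of_nonneg_of_le (fun i => mul_nonneg (Finset.prod_nonneg fun m _ => by
      positivity) (hw i)) (fun i => ?_)
      (summable_prod_comp (M := M) (fun k => by positivity)
        -- One power `θ` comes from the weight, the other from the norm of `Δ_i` contained in `w`.
        (summable_rpow_mul_geometric (θ := θ + θ) hc hs0 hs1))
    rw [← Finset.prod_mul_distrib]
    refine Finset.prod_le_prod (fun m _ => by positivity) fun m _ => ?_
    rw [Real.rpow_add (by positivity), mul_assoc]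
    gcongr
    linarith
  have hws : Summable w := by
    refine Summable.of_nonneg_of_le hw (fun i => le_mul_of_one_le_left (hw i) ?_) hgeo
    calc (1 : ℝ) = ∏ _m : Fin M, (1 : ℝ) := by simp
      _ ≤ ∏ m, (1 + c * ((i m : ℝ) + 1)) ^ θ :=
        Finset.prod_le_prod (fun _ _ => zero_le_one) fun m _ =>
          Real.one_le_rpow (le_add_of_nonneg_right (by positivity)) hθ
  have hn : ∀ i y, HasSum (fun n => tensorDetail node g i (v n) y) (tensorDetail node g i u y) :=
    fun i y => hasSum_sum fun j _ => (hvu _).const_smul _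
  refine ⟨fun i => w i * ∑' n : ℕ, C * s ^ n, fun i => mul_nonneg (hw i)
    (tsum_nonneg fun n => by positivity), ?_, fun i y => ?_, fun y => ?_⟩
  · simpa only [mul_assoc] using hgeo.mul_right (∑' n : ℕ, C * s ^ n)
  · rw [← (hn i y).tsum_eq]
    exact (tsum_of_norm_bounded (hsum.mul_left (w i)).hasSum (hb y i)).trans_eq tsum_mul_left
  -- The double series converges absolutely. Summing over `n` first gives the details of `u`;
  -- summing over `i` first is a finite sum reproducing `v n`.
  · have hprod : Summable fun x : (Fin M → ℕ) × ℕ => tensorDetail node g x.1 (v x.2) y :=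
      Summable.of_norm_bounded (hws.mul_of_nonneg hsum hw fun n => by positivity)
        fun x => hb y x.1 x.2
    have h1 := hprod.hasSum.prod_fiberwise fun i => hn i y
    have hfin : ∀ n, HasSum (fun i => tensorDetail node g i (v n) y) (v n y) := fun n => by
      have h : HasSum (fun i => tensorDetail node g i (v n) y)
          (∑ i ∈ Fintype.piFinset fun _ : Fin M => Finset.range (n + 1),
            tensorDetail node g i (v n) y) := hasSum_sum_of_ne_finset_zero fun i hi => by
          refine congrFun (hzero i n ?_) y
          simp only [Fintype.mem_piFinset, Finset.mem_range, not_forall, not_lt] at hi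
          obtain ⟨m, hm⟩ := hi
          exact hm.trans (Finset.single_le_sum (f := i) (fun _ _ => Nat.zero_le _)
            (Finset.mem_univ m))
      have hS : ∀ ν ∈ {ν : Fin M → ℕ | ∑ m, ν m ≤ n}, ∀ m, ν m ≤ g n := fun ν hν m =>
        ((Finset.single_le_sum (f := ν) (fun _ _ => Nat.zero_le _)
          (Finset.mem_univ m)).trans hν).trans hg.le_apply
      rwa [← Finset.sum_apply, sum_tensorDetail_of_mem_polySpan hnode hg hS (hv n)] at h
    have h2 := ((Equiv.prodComm _ _).hasSum_iff.2 hprod.hasSum).prod_fiberwise (fun n => hfin n)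
    rwa [h2.unique (hvu y)] at h1

/-! ### Index sets of adaptive runs -/

section IndexSets

variable {M : ℕ}

/-- Union distributes over the intersection, and an intersection of lower sets is lower. -/
theorem isLowerSet_union_envelope {Λ : Set (Fin M → ℕ)} {k : Fin M → ℕ} :
    IsLowerSet (Λ ∪ envelope Λ k) := by
  rw [envelope, Set.sInter_eq_biInter, Set.union_iInter₂]
  exact isLowerSet_iInter₂ fun E hE => hE.2.2

theorem mem_envelope_self (Λ : Set (Fin M → ℕ)) (k : Fin M → ℕ) : k ∈ envelope Λ k :=
  Set.mem_sInter.2 fun _ hE => hE.2.1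

/-- If `k ∉ Λ`, then `k m = i m + 1`, so `k - e_m ≤ i` lies in `Λ`. -/
theorem mem_or_mem_margin_of_le {Λ : Set (Fin M → ℕ)} {i k : Fin M → ℕ} (hΛ : IsLowerSet Λ)
    (hi : i ∈ Λ) {m : Fin M} (hk : k ≤ i + Pi.single m 1) : k ∈ Λ ∨ k ∈ margin Λ := by
  by_cases hkΛ : k ∈ Λ
  · exact Or.inl hkΛ
  have hkm : k m = i m + 1 := by
    by_contra h
    refine hkΛ (hΛ (fun l => ?_) hi)
    have := hk l
    change k l ≤ i l
    by_cases hl : l = m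
    · subst hl
      have : k l ≤ i l + 1 := by simpa using this
      omega
    · simpa [hl] using this
  refine Or.inr ⟨hkΛ, m, k - Pi.single m 1, hΛ (fun l => ?_) hi, ?_⟩
  · have := hk l
    simp only [Pi.sub_apply, Pi.add_apply] at this ⊢
    omega
  · ext l
    by_cases hl : l = m
    · subst hl
      simp [hkm]
    · simp [hl]

end IndexSets

/-! ### Convergence of the adaptive algorithm for affine parametric operators -/

section Affine

variable {M : ℕ} {V W : Type*} [NormedAddCommGroup V] [NormedSpace ℝ V]
  [NormedAddCommGroup W] [NormedSpace ℝ W] {node : ℕ → I} {g : ℕ → ℕ}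

/-- The operator `L₀ + ∑ y_m L_m`, depending affinely on `y`. -/
def affineOp (L₀ : V →L[ℝ] W) (L : Fin M → V →L[ℝ] W) (y : Fin M → I) : V →L[ℝ] W :=
  L₀ + ∑ m, (y m : ℝ) • L m

theorem affineOp_apply (L₀ : V →L[ℝ] W) (L : Fin M → V →L[ℝ] W) (y : Fin M → I) (v : V) :
    affineOp L₀ L y v = L₀ v + ∑ m, (y m : ℝ) • L m v := by
  simp [affineOp]

theorem norm_affineOp_le (L₀ : V →L[ℝ] W) (L : Fin M → V →L[ℝ] W) (y : Fin M → I) :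
    ‖affineOp L₀ L y‖ ≤ ‖L₀‖ + ∑ m, ‖L m‖ := by
  refine (norm_add_le _ _).trans (add_le_add_right ((norm_sum_le _ _).trans
    (Finset.sum_le_sum fun m _ => ?_)) _)
  rw [norm_smul]
  exact mul_le_of_le_one_left (norm_nonneg _) (abs_le.2 (y m).2)

/-- `Δ_i u` has degree at most `g (i l)` in `y l`, and each affine term adds at most one to one of
these degrees. Strict growth gives `g (i l) + 1 ≤ g (i l + 1)`, so level `i + e_m` already resolves
the product. -/
theorem tensorDetail_affineOp_eq_zero (hnode : Function.Injective node) (hg : StrictMono g)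
    (L₀ : V →L[ℝ] W) (L : Fin M → V →L[ℝ] W) {i k : Fin M → ℕ} (hki : ¬ k ≤ i)
    (hki' : ∀ m, ¬ k ≤ i + Pi.single m 1) (u : (Fin M → I) → V) :
    tensorDetail node g k (fun y => affineOp L₀ L y (tensorDetail node g i u y)) = 0 := by
  have hmem := tensorDetail_mem_polySpan hnode hg i u
  have h0 : tensorDetail node g k (fun y => L₀ (tensorDetail node g i u y)) = 0 := by
    refine tensorDetail_eq_zero_of_mem_polySpan hnode hg ?_ (map_mem_polySpan (L₀ : V →ₗ[ℝ] W) hmem)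
    rintro _ rfl
    obtain ⟨l, hl⟩ := not_forall.1 hki
    replace hl : i l < k l := not_le.1 hl
    exact ⟨l, k l - 1, by omega, hg.monotone (by omega)⟩
  have hm : ∀ m, tensorDetail node g k
      (fun y => (y m : ℝ) • L m (tensorDetail node g i u y)) = 0 := by
    intro m
    refine tensorDetail_eq_zero_of_mem_polySpan hnode hg
      (S := {fun l => g (i l) + (Pi.single m 1 : Fin M → ℕ) l}) ?_
      (coord_smul_mem_polySpan m ?_ (map_mem_polySpan (L m : V →ₗ[ℝ] W) hmem))
    · rintro _ rfl
      obtain ⟨l, hl⟩ := not_forall.1 (hki' m)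
      replace hl : i l + (Pi.single m 1 : Fin M → ℕ) l < k l := not_le.1 hl
      refine ⟨l, k l - 1, by omega, ?_⟩
      have hle := hg.add_le_nat ((Pi.single m 1 : Fin M → ℕ) l) (i l)
      rw [add_comm] at hle
      exact hle.trans (hg.monotone (by omega))
    · rintro _ rfl
      rfl
  have : (fun y => affineOp L₀ L y (tensorDetail node g i u y))
      = (fun y => L₀ (tensorDetail node g i u y))
        + ∑ m, fun y => (y m : ℝ) • L m (tensorDetail node g i u y) := by
    ext y
    simp [affineOp_apply]
  rw [this, ← tensorDetailₗ_apply, map_add, map_sum]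
  simp [tensorDetailₗ_apply, h0, hm]

theorem tensorDetail_affineOp_sparse (L₀ : V →L[ℝ] W) (L : Fin M → V →L[ℝ] W)
    (Λ : Finset (Fin M → ℕ)) (k : Fin M → ℕ) (u : (Fin M → I) → V) :
    tensorDetail node g k (fun y => affineOp L₀ L y (sparse node g Λ u y))
      = ∑ i ∈ Λ, tensorDetail node g k
          (fun y => affineOp L₀ L y (tensorDetail node g i u y)) := by
  have : (fun y => affineOp L₀ L y (sparse node g Λ u y))
      = ∑ i ∈ Λ, fun y => affineOp L₀ L y (tensorDetail node g i u y) := by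
    ext y
    simp [sparse]
  rw [this, ← tensorDetailₗ_apply, map_sum]
  rfl

theorem tensorDetail_affineOp_sparse_eq_zero (hnode : Function.Injective node)
    (hg : StrictMono g) (L₀ : V →L[ℝ] W) (L : Fin M → V →L[ℝ] W) {Λ : Finset (Fin M → ℕ)}
    (hΛ : IsLowerSet (Λ : Set (Fin M → ℕ))) {k : Fin M → ℕ} (hk : k ∉ Λ)
    (hk' : k ∉ margin (Λ : Set (Fin M → ℕ))) (u : (Fin M → I) → V) :
    tensorDetail node g k (fun y => affineOp L₀ L y (sparse node g Λ u y)) = 0 := by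
  rw [tensorDetail_affineOp_sparse]
  refine Finset.sum_eq_zero fun i hi => tensorDetail_affineOp_eq_zero hnode hg L₀ L
    (fun h => hk (hΛ h hi)) (fun m h => ?_) u
  exact (mem_or_mem_margin_of_le hΛ hi h).elim hk hk'

/-- The right side does not depend on `Λ`; this is what allows `k` and the index set to vary
together along the algorithm. -/
theorem norm_tensorDetail_affineOp_sparse_le (hnode : Function.Injective node)
    (hg : StrictMono g) {c θ : ℝ} (hc : 0 ≤ c) (hθ : 0 ≤ θ)
    (hΔ : ∀ k : ℕ, ‖detail node g k‖ ≤ (1 + c * (k : ℝ)) ^ θ)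
    (L₀ : V →L[ℝ] W) (L : Fin M → V →L[ℝ] W) {u : (Fin M → I) → V} {δ : (Fin M → ℕ) → ℝ}
    (hδ0 : ∀ i, 0 ≤ δ i) (hδ : Summable fun i => (∏ m, (1 + c * ((i m : ℝ) + 1)) ^ θ) * δ i)
    (hu : ∀ i y, ‖tensorDetail node g i u y‖ ≤ δ i) (Λ : Finset (Fin M → ℕ)) (k : Fin M → ℕ)
    (y : Fin M → I) :
    ‖tensorDetail node g k (fun y => affineOp L₀ L y (sparse node g Λ u y)) y‖
      ≤ (‖L₀‖ + ∑ m, ‖L m‖) * ∑' i, {i | k ≤ i + 1}.indicator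
          (fun i => (∏ m, (1 + c * ((i m : ℝ) + 1)) ^ θ) * δ i) i := by
  set A := ‖L₀‖ + ∑ m, ‖L m‖
  have hA : 0 ≤ A := by positivity
  have hnn : ∀ i, 0 ≤ (∏ m, (1 + c * ((i m : ℝ) + 1)) ^ θ) * δ i := fun i =>
    mul_nonneg (Finset.prod_nonneg fun m _ => by positivity) (hδ0 i)
  have hterm : ∀ i, ‖tensorDetail node g k
      (fun y => affineOp L₀ L y (tensorDetail node g i u y)) y‖
      ≤ A * {i | k ≤ i + 1}.indicator
          (fun i => (∏ m, (1 + c * ((i m : ℝ) + 1)) ^ θ) * δ i) i := by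
    intro i
    -- Here `1` is the all-ones index, so `k ≤ i + 1` covers `k ≤ i` and all `k ≤ i + e_m` at once,
    -- and it bounds the norm of `Δ_k` by the weight at `i`.
    by_cases h : k ≤ i + 1
    · rw [Set.indicator_of_mem (show i ∈ {i | k ≤ i + 1} from h)]
      have hb : ∀ y, ‖affineOp L₀ L y (tensorDetail node g i u y)‖ ≤ A * δ i := fun y =>
        ((affineOp L₀ L y).le_opNorm _).trans
          (mul_le_mul (norm_affineOp_le L₀ L y) (hu i y) (norm_nonneg _) hA)
      calc _ ≤ (∏ m, ‖detail node g (k m)‖) * (A * δ i) := norm_tensorDetail_le hnode hg k hb y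
        _ ≤ (∏ m, (1 + c * ((i m : ℝ) + 1)) ^ θ) * (A * δ i) := by
            refine mul_le_mul_of_nonneg_right (Finset.prod_le_prod
              (fun m _ => ContinuousLinearMap.opNorm_nonneg _) fun m _ => (hΔ _).trans ?_)
              (mul_nonneg hA (hδ0 i))
            have hm : (k m : ℝ) ≤ (i m : ℝ) + 1 := by exact_mod_cast h m
            gcongr
        _ = _ := by ring
    · rw [tensorDetail_affineOp_eq_zero hnode hg L₀ L
        (fun h' => h (h'.trans (le_add_of_nonneg_right zero_le_one)))
        (fun m h' => h (h'.trans (add_le_add_right (fun l => ?_) i))) u]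
      · simp [h]
      · by_cases hl : l = m
        · subst hl
          simp
        · simp [hl]
  rw [tensorDetail_affineOp_sparse, Finset.sum_apply]
  refine (norm_sum_le_of_le _ fun i _ => hterm i).trans ?_
  rw [← Finset.mul_sum]
  exact mul_le_mul_of_nonneg_left ((hδ.indicator _).sum_le_tsum _
    fun i _ => Set.indicator_nonneg (fun i _ => hnn i) i) hA

/-- Each `i` contributes for only finitely many `k`, so dominated convergence applies. -/
theorem tendsto_tsum_indicator_le_add_one {f : (Fin M → ℕ) → ℝ} (hf : Summable f) :
    Tendsto (fun k : Fin M → ℕ => ∑' i, {i | k ≤ i + 1}.indicator f i) cofinite (𝓝 0) := by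
  have h := tendsto_tsum_of_dominated_convergence (𝓕 := (cofinite : Filter (Fin M → ℕ)))
    (f := fun k i => {i | k ≤ i + 1}.indicator f i) (g := fun _ => (0 : ℝ)) hf.norm
    (fun i => ?_) (Eventually.of_forall fun k i => norm_indicator_le_norm_self _ _)
  · simpa using h
  · refine tendsto_const_nhds.congr' ?_
    have : {k : Fin M → ℕ | k ≤ i + 1}.Finite := Set.finite_Iic (i + 1)
    filter_upwards [this.compl_mem_cofinite] with k hk
    rw [Set.indicator_of_notMem]
    exact hk

variable {ι : Type*} [CompleteSpace V] {μ : Measure (Fin M → I)} [IsProbabilityMeasure μ]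
  [μ.IsOpenPosMeasure]

/-- With total mass one, sup bounds control every `L^p` norm, so all `p` including `∞` are treated
alike. -/
theorem eLpNorm_le_ofReal_of_norm_le {Ω E : Type*} [MeasurableSpace Ω] [NormedAddCommGroup E]
    {P : Measure Ω} [IsProbabilityMeasure P] {F : Ω → E} {B : ℝ} (hB : ∀ y, ‖F y‖ ≤ B) (p : ℝ≥0∞) :
    eLpNorm F p P ≤ ENNReal.ofReal B := by
  simpa using eLpNorm_le_of_ae_bound (p := p) (μ := P) (Eventually.of_forall hB)

set_option maxHeartbeats 1000000 in
/-- Convergence of the adaptive algorithm for a solution map `u` of the affine parametric problem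
`T w ((L₀ + ∑ y_m L_m) v) = b w` for all `w`. -/
theorem tendsto_eLpNorm_sub_sparse (hnode : Function.Injective node) (hg : StrictMono g)
    {c θ : ℝ} (hc : 0 ≤ c) (hθ : 0 ≤ θ)
    (hΔ : ∀ k : ℕ, ‖detail node g k‖ ≤ (1 + c * (k : ℝ)) ^ θ)
    (L₀ : V →L[ℝ] W) (L : Fin M → V →L[ℝ] W) (T : ι → W →L[ℝ] ℝ) (b : ι → ℝ)
    {u : (Fin M → I) → V} (hu : ∀ y w, T w (affineOp L₀ L y (u y)) = b w)
    (huniq : ∀ y v, (∀ w, T w (affineOp L₀ L y v) = b w) → v = u y)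
    {δ : (Fin M → ℕ) → ℝ} (hδ0 : ∀ i, 0 ≤ δ i)
    (hδ : Summable fun i => (∏ m, (1 + c * ((i m : ℝ) + 1)) ^ θ) * δ i)
    (huδ : ∀ i y, ‖tensorDetail node g i u y‖ ≤ δ i)
    (husum : ∀ y, HasSum (fun i => tensorDetail node g i u y) (u y)) {p : ℝ≥0∞} (hp : 1 ≤ p)
    {Λ : ℕ → Finset (Fin M → ℕ)} (hΛ0 : Λ 0 = {0})
    (hΛ : ∀ n, ∃ k ∈ margin (Λ n : Set (Fin M → ℕ)),
      (∀ i ∈ margin (Λ n : Set (Fin M → ℕ)),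
        eLpNorm (tensorDetail node g i fun y => affineOp L₀ L y (sparse node g (Λ n) u y)) p μ
        ≤ eLpNorm (tensorDetail node g k fun y => affineOp L₀ L y (sparse node g (Λ n) u y)) p μ) ∧
      (Λ (n + 1) : Set (Fin M → ℕ))
        = (Λ n : Set (Fin M → ℕ)) ∪ envelope (Λ n : Set (Fin M → ℕ)) k) :
    MemLp u p μ ∧ (∀ n, MemLp (sparse node g (Λ n) u) p μ) ∧
      Tendsto (fun n => eLpNorm (u - sparse node g (Λ n) u) p μ) atTop (𝓝 0) := by
  choose κ hκm hκmax hκ using hΛ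
  have hδs : Summable δ := by
    refine Summable.of_nonneg_of_le hδ0 (fun i => le_mul_of_one_le_left (hδ0 i) ?_) hδ
    calc (1 : ℝ) = ∏ _m : Fin M, (1 : ℝ) := by simp
      _ ≤ ∏ m, (1 + c * ((i m : ℝ) + 1)) ^ θ :=
        Finset.prod_le_prod (fun _ _ => zero_le_one) fun m _ =>
          Real.one_le_rpow (le_add_of_nonneg_right (by positivity)) hθ
  have hp0 : p ≠ 0 := (zero_lt_one.trans_le hp).ne'
  have hcont : ∀ i (F : (Fin M → I) → V), Continuous (tensorDetail node g i F) := fun i F =>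
    continuous_of_mem_polySpan (tensorDetail_mem_polySpan hnode hg i F)
  have hcontW : ∀ i (F : (Fin M → I) → W), Continuous (tensorDetail node g i F) := fun i F =>
    continuous_of_mem_polySpan (tensorDetail_mem_polySpan hnode hg i F)
  have hlow : ∀ n, IsLowerSet (Λ n : Set (Fin M → ℕ)) := by
    intro n
    cases n with
    | zero =>
      rw [hΛ0, Finset.coe_singleton]
      rintro a b hba rfl
      exact le_antisymm hba zero_le
    | succ n =>
      rw [hκ n]
      exact isLowerSet_union_envelope
  have hmono : Monotone Λ := monotone_nat_of_le_succ fun n => by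
    rw [← Finset.coe_subset, hκ n]
    exact Set.subset_union_left
  have hκmem : ∀ n, κ n ∈ Λ (n + 1) := fun n => by
    rw [← Finset.mem_coe, hκ n]
    exact Or.inr (mem_envelope_self _ _)
  -- A selected index enters the set at once, stays there, and so never lies in a later margin.
  have hκne : ∀ n l, n < l → κ n ≠ κ l := fun n l hnl h =>
    (hκm l).1 (h ▸ hmono (Nat.succ_le_of_lt hnl) (hκmem n))
  have hκinj : Function.Injective κ := fun n l h => by
    by_contra hne
    exact (Ne.lt_or_gt hne).elim (fun hl => hκne _ _ hl h) fun hl => hκne _ _ hl h.symm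
  have hκlim : Tendsto κ atTop cofinite := by
    rw [← Nat.cofinite_eq_atTop]
    exact hκinj.tendsto_cofinite
  set F : ℕ → (Fin M → I) → W := fun n y => affineOp L₀ L y (sparse node g (Λ n) u y) with hF
  have hest : Tendsto (fun n => eLpNorm (tensorDetail node g (κ n) (F n)) p μ) atTop (𝓝 0) := by
    have h := ((tendsto_tsum_indicator_le_add_one hδ).comp hκlim).const_mul (‖L₀‖ + ∑ m, ‖L m‖)
    have h' := ENNReal.tendsto_ofReal h
    rw [mul_zero, ENNReal.ofReal_zero] at h'
    exact tendsto_of_tendsto_of_tendsto_of_le_of_le tendsto_const_nhds h' (fun _ => zero_le)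
      fun n => eLpNorm_le_ofReal_of_norm_le (fun y =>
        norm_tensorDetail_affineOp_sparse_le hnode hg hc hθ hΔ L₀ L hδ0 hδ huδ _ _ y) p
  have hest' : ∀ k, (∀ n, k ∉ Λ n) →
      Tendsto (fun n => eLpNorm (tensorDetail node g k (F n)) p μ) atTop (𝓝 0) := by
    intro k hk
    refine tendsto_of_tendsto_of_tendsto_of_le_of_le tendsto_const_nhds hest (fun _ => zero_le)
      fun n => ?_
    -- On the margin the estimator is below the maximum; off both `Λ n` and its margin it is zero.
    by_cases hkm : k ∈ margin (Λ n : Set (Fin M → ℕ))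
    · exact hκmax n k hkm
    · change eLpNorm (tensorDetail node g k (F n)) p μ ≤ _
      rw [hF, tensorDetail_affineOp_sparse_eq_zero hnode hg L₀ L (hlow n) (hk n) hkm, eLpNorm_zero]
      exact zero_le
  set S : Set (Fin M → ℕ) := ⋃ n, (Λ n : Set (Fin M → ℕ)) with hS
  have hΛS : ∀ n, (Λ n : Set (Fin M → ℕ)) ⊆ S := fun n =>
    Set.subset_iUnion (fun n => (Λ n : Set (Fin M → ℕ))) n
  set v : (Fin M → I) → V := fun y => ∑' i, S.indicator (fun i => tensorDetail node g i u y) i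
  have hev : ∀ i ∈ S, ∀ᶠ n in atTop, i ∈ Λ n := fun i hi => by
    obtain ⟨n, hn⟩ := Set.mem_iUnion.1 hi
    filter_upwards [eventually_ge_atTop n] with l hl using hmono hl hn
  have hvlim : ∀ y, Tendsto (fun n => sparse node g (Λ n) u y) atTop (𝓝 (v y)) := by
    intro y
    have hsp : ∀ n, sparse node g (Λ n) u y = ∑' i, (Λ n : Set (Fin M → ℕ)).indicator
        (fun i => tensorDetail node g i u y) i := fun n => by
      rw [sparse, Finset.sum_apply, sum_eq_tsum_indicator]
    simp only [hsp]
    refine tendsto_tsum_of_dominated_convergence (bound := δ) hδs (fun i => ?_)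
      (Eventually.of_forall fun n i => (norm_indicator_le_norm_self
        (fun i => tensorDetail node g i u y) i).trans (huδ i y))
    by_cases hi : i ∈ S
    · refine tendsto_const_nhds.congr' ?_
      filter_upwards [hev i hi] with n hn
      rw [Set.indicator_of_mem hi, Set.indicator_of_mem (Finset.mem_coe.2 hn)]
    · rw [Set.indicator_of_notMem hi]
      refine tendsto_const_nhds.congr fun n => ?_
      rw [Set.indicator_of_notMem fun h => hi (hΛS n h)]
  set G : (Fin M → I) → W := fun y => affineOp L₀ L y (v y) with hG
  have hFG : ∀ y, Tendsto (fun n => F n y) atTop (𝓝 (G y)) := fun y =>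
    ((affineOp L₀ L y).continuous.tendsto _).comp (hvlim y)
  have hGzero : ∀ k ∉ S, tensorDetail node g k G = 0 := by
    intro k hk
    have hk' : ∀ n, k ∉ Λ n := fun n h => hk (hΛS n h)
    -- By Fatou, `Δ_k G` has norm zero; being continuous, it vanishes everywhere because `μ` charges
    -- open sets.
    have hle := Lp.eLpNorm_lim_le_liminf_eLpNorm (p := p) (μ := μ)
      (fun n => (hcontW k (F n)).aestronglyMeasurable) (tensorDetail node g k G)
      (Eventually.of_forall (tendsto_tensorDetail k hFG))
    rw [(hest' k hk').liminf_eq, nonpos_iff_eq_zero,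
      eLpNorm_eq_zero_iff (hcontW k G).aestronglyMeasurable hp0] at hle
    exact ((hcontW k G).ae_eq_iff_eq μ continuous_zero).1 hle
  have hgrid : ∀ k ∈ S, ∀ j : Fin M → ℕ, (∀ m, j m ≤ g (k m)) →
      v (fun m => node (j m)) = u fun m => node (j m) := by
    intro k hk j hj
    refine tendsto_nhds_unique (hvlim _) (tendsto_const_nhds.congr' ?_)
    filter_upwards [hev k hk] with n hn using (sparse_apply_node hnode hg (hlow n) hn hj u).symm
  have hres : ∀ w k, tensorDetail node g k (fun y => T w (G y) - b w) = 0 := by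
    intro w k
    by_cases hk : k ∈ S
    · refine (tensorDetail_congr fun j hj => ?_).trans (tensorDetail_zero k)
      simp only [hG, hgrid k hk j hj, hu, sub_self, Pi.zero_apply]
    · have h1 : tensorDetail node g k (fun y => T w (G y)) = 0 := by
        ext1 y
        rw [← ContinuousLinearMap.coe_coe, tensorDetail_comp, hGzero k hk]
        simp
      have h2 : tensorDetail node g k (fun _ => b w) = 0 := by
        -- The right-hand side is constant in `y`, and only `Δ_0` sees constants; `0` belongs to `S`
        -- from the start.
        have hk0 : k ≠ 0 := fun h => hk (hΛS 0 (by simp [h, hΛ0]))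
        obtain ⟨m, hm⟩ := Function.ne_iff.1 hk0
        refine tensorDetail_eq_zero_of_mem_polySpan hnode hg ?_
          (const_mem_polySpan (Set.mem_singleton 0) _)
        rintro _ rfl
        exact ⟨m, k m - 1, (Nat.succ_pred hm).symm, zero_le⟩
      have : (fun y => T w (G y) - b w) = (fun y => T w (G y)) - fun _ => b w := rfl
      rw [this, ← tensorDetailₗ_apply, map_sub, tensorDetailₗ_apply, tensorDetailₗ_apply, h1, h2,
        sub_zero]
  have hnodes : ∀ j : Fin M → ℕ, v (fun m => node (j m)) = u fun m => node (j m) := by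
    intro j
    refine huniq _ _ fun w => ?_
    -- All details of the residual vanish, so its interpolant on the box below `j` is zero. This box
    -- reaches node `j` since `j m ≤ g (j m)`.
    have h := sparse_apply_node hnode hg (Λ := Finset.Iic j)
      (by simpa using isLowerSet_Iic j) (Finset.mem_Iic.2 le_rfl)
      (fun m => hg.le_apply) fun y => T w (G y) - b w
    rw [sparse, Finset.sum_eq_zero fun i _ => hres w i] at h
    exact sub_eq_zero.1 h.symm
  have huzero : ∀ k ∉ S, tensorDetail node g k u = 0 := by
    intro k hk
    ext1 y
    rw [← tensorDetail_congr fun j _ => hnodes j]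
    -- `Δ_k u = Δ_k v` because `u` and `v` agree at the nodes, and `Δ_k` kills every partial sum
    -- since `k ∉ S`.
    refine tendsto_nhds_unique (tendsto_tensorDetail k hvlim y) (tendsto_const_nhds.congr fun n => ?_)
    rw [sparse, ← tensorDetailₗ_apply, map_sum, Finset.sum_eq_zero fun i hi => ?_, Pi.zero_apply]
    refine tensorDetail_tensorDetail_of_ne hnode hg ?_ u
    rintro rfl
    exact hk (hΛS n hi)
  have hucont : Continuous u := by
    have : u = fun y => ∑' i, tensorDetail node g i u y := funext fun y => (husum y).tsum_eq.symm
    rw [this]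
    exact continuous_tsum (fun i => hcont i u) hδs huδ
  have hscont : ∀ n, Continuous (sparse node g (Λ n) u) := fun n => by
    have : sparse node g (Λ n) u = fun y => ∑ i ∈ Λ n, tensorDetail node g i u y := by
      ext y
      simp [sparse]
    rw [this]
    exact continuous_finsetSum _ fun i _ => hcont i u
  refine ⟨MemLp.of_bound hucont.aestronglyMeasurable (∑' i, δ i) (Eventually.of_forall fun y => ?_),
    fun n => MemLp.of_bound (hscont n).aestronglyMeasurable (∑ i ∈ Λ n, δ i)
      (Eventually.of_forall fun y => ?_), ?_⟩
  · rw [← (husum y).tsum_eq]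
    exact tsum_of_norm_bounded hδs.hasSum fun i => huδ i y
  · rw [sparse, Finset.sum_apply]
    exact norm_sum_le_of_le _ fun i _ => huδ i y
  have htail : Tendsto (fun n => ∑' i, (S \ Λ n).indicator δ i) atTop (𝓝 0) := by
    have h := tendsto_tsum_of_dominated_convergence (𝓕 := atTop)
      (f := fun n i => (S \ Λ n).indicator δ i) (g := fun _ => (0 : ℝ)) hδs.norm
      (fun i => ?_) (Eventually.of_forall fun k i => norm_indicator_le_norm_self _ _)
    · simpa using h
    · refine tendsto_const_nhds.congr' ?_
      by_cases hi : i ∈ S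
      · filter_upwards [hev i hi] with n hn
        rw [Set.indicator_of_notMem fun h => h.2 hn]
      · exact Eventually.of_forall fun n => (Set.indicator_of_notMem (fun h => hi h.1) _).symm
  have htail' := ENNReal.tendsto_ofReal htail
  rw [ENNReal.ofReal_zero] at htail'
  refine tendsto_of_tendsto_of_tendsto_of_le_of_le tendsto_const_nhds htail' (fun _ => zero_le)
    fun n => eLpNorm_le_ofReal_of_norm_le (fun y => ?_) p
  have hs : HasSum ((Λ n : Set (Fin M → ℕ)).indicator fun i => tensorDetail node g i u y)
      (sparse node g (Λ n) u y) := by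
    rw [sparse, Finset.sum_apply, ← Finset.sum_indicator_subset _ subset_rfl]
    exact hasSum_sum_of_ne_finset_zero fun i hi =>
      Set.indicator_of_notMem (fun h => hi (Finset.mem_coe.1 h)) _
  rw [Pi.sub_apply, ← ((husum y).sub hs).tsum_eq]
  refine tsum_of_norm_bounded (hδs.indicator _).hasSum fun i => ?_
  by_cases hi : i ∈ S
  · by_cases hin : i ∈ Λ n
    · rw [Set.indicator_of_mem (Finset.mem_coe.2 hin), sub_self, norm_zero]
      exact Set.indicator_nonneg (fun i _ => hδ0 i) i
    · rw [Set.indicator_of_notMem (fun h => hin (Finset.mem_coe.1 h)), sub_zero,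
        Set.indicator_of_mem (show i ∈ S \ Λ n from ⟨hi, hin⟩)]
      exact huδ i y
  · rw [Set.indicator_of_notMem (fun h => hi (hΛS n h)), huzero i hi]
    simpa using Set.indicator_nonneg (fun i _ => hδ0 i) i

end Affine

/-! ### The uniform measure -/

theorem measure_comap_val_univ :
    (Measure.comap (Subtype.val : I → ℝ) volume) Set.univ = 2 := by
  rw [(MeasurableEmbedding.subtype_coe measurableSet_Icc).comap_apply, Set.image_univ,
    Subtype.range_coe, Real.volume_Icc]
  norm_num

instance : IsProbabilityMeasure
    ((2⁻¹ : ℝ≥0∞) • Measure.comap (Subtype.val : I → ℝ) volume) :=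
  ⟨by rw [Measure.smul_apply, measure_comap_val_univ, smul_eq_mul,
    ENNReal.inv_mul_cancel two_ne_zero ENNReal.ofNat_ne_top]⟩

instance : ((2⁻¹ : ℝ≥0∞) • Measure.comap (Subtype.val : I → ℝ) volume).IsOpenPosMeasure := by
  refine ⟨fun U hU hne => ?_⟩
  rw [Measure.smul_apply, smul_eq_mul,
    (MeasurableEmbedding.subtype_coe measurableSet_Icc).comap_apply]
  refine mul_ne_zero (ENNReal.inv_ne_zero.2 ENNReal.ofNat_ne_top) ?_
  obtain ⟨O, hO, rfl⟩ := isOpen_induced_iff.1 hU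
  obtain ⟨x, hx⟩ := hne
  -- The given point may be an endpoint, so the open set is first moved into the open interval.
  have hcl : (x : ℝ) ∈ closure (Set.Ioo (-1 : ℝ) 1) := by
    rw [closure_Ioo (by norm_num)]
    exact x.2
  refine fun h => (hO.inter isOpen_Ioo).measure_ne_zero volume (mem_closure_iff.1 hcl O hO hx)
    (measure_mono_null ?_ h)
  rintro z ⟨hzO, hz⟩
  exact ⟨⟨z, Set.Ioo_subset_Icc_self hz⟩, hzO, rfl⟩

instance (M : ℕ) : IsProbabilityMeasure (unif M) := by
  unfold unif
  infer_instance

instance (M : ℕ) : (unif M).IsOpenPosMeasure := by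
  unfold unif
  infer_instance

/-! ### The Poincaré inequality -/

section Poincare

variable {d : ℕ} {D : Set (Space d)}

theorem gradient_eq_zero_of_notMem_tsupport {φ : Space d → ℝ} {x : Space d}
    (hx : x ∉ tsupport φ) : gradient φ x = 0 := by
  rw [gradient, image_eq_zero_of_notMem_tsupport fun h => hx (tsupport_fderiv_subset ℝ h), map_zero]

theorem continuous_gradient {φ : Space d → ℝ} (hφ : ContDiff ℝ ∞ φ) : Continuous (gradient φ) :=
  (LinearIsometryEquiv.continuous _).comp (hφ.continuous_fderiv (by simp))

/-- Integrating by parts against one coordinate gives `∫ φ² = -∫ x₁ ∂₁(φ²)`. Young's inequality with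
`|x₁| ≤ R` on the support leaves `½ ∫ φ²`, which is absorbed, and `2R² ∫ |∇φ|²`. -/
theorem integral_sq_le_integral_gradient_sq (hd : 0 < d) {R : ℝ}
    (hR : ∀ x ∈ D, ‖x‖ ≤ R) {φ : Space d → ℝ} (hφ : ContDiff ℝ ∞ φ) (hφc : HasCompactSupport φ)
    (hφD : tsupport φ ⊆ D) :
    ∫ x, φ x ^ 2 ≤ (2 * R) ^ 2 * ∫ x, ‖gradient φ x‖ ^ 2 := by
  set i : Fin d := ⟨0, hd⟩
  set e : Space d := EuclideanSpace.single i 1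
  let P : Space d →L[ℝ] ℝ := EuclideanSpace.proj i
  have hPe : P e = 1 := by simp [P, e]
  have hφd : Differentiable ℝ φ := hφ.differentiable (by simp)
  have hsq : ∀ x, HasFDerivAt (fun x => φ x ^ 2) ((2 * φ x) • fderiv ℝ φ x) x := fun x => by
    simpa using (hφd x).hasFDerivAt.pow 2
  have hsqd : ∀ x, fderiv ℝ (fun x => φ x ^ 2) x e = 2 * φ x * fderiv ℝ φ x e := fun x => by
    rw [(hsq x).fderiv]
    rfl
  have hcφ' : Continuous fun x => fderiv ℝ φ x e :=
    (hφ.continuous_fderiv (by simp)).clm_apply continuous_const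
  have hcg := continuous_gradient hφ
  have hI : ∀ {h : Space d → ℝ}, Continuous h → (∀ x, φ x = 0 → h x = 0) → Integrable h :=
    fun hc h0 => hc.integrable_of_hasCompactSupport (hφc.mono fun x hx hφx => hx (h0 x hφx))
  have hIφ : Integrable fun x => φ x ^ 2 := hI (hφ.continuous.pow 2) fun x hx => by simp [hx]
  have hIg : Integrable fun x => ‖gradient φ x‖ ^ 2 := by
    refine (hcg.norm.pow 2).integrable_of_hasCompactSupport
      (hφc.mono' fun x hx => ?_)
    by_contra h
    exact hx (by simp [gradient_eq_zero_of_notMem_tsupport h])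
  have hcP := P.continuous
  have hcont := hφ.continuous
  have hparts : ∫ x, P x * fderiv ℝ (fun x => φ x ^ 2) x e
      = -∫ x, fderiv ℝ P x e * φ x ^ 2 := by
    refine integral_mul_fderiv_eq_neg_fderiv_mul_of_integrable ?_ ?_ ?_
      (fun x _ => P.differentiableAt) fun x _ => (hsq x).differentiableAt
    · simpa [hPe] using hIφ
    · simp only [hsqd]
      exact hI (by fun_prop) fun x hx => by simp [hx]
    · exact hI (by fun_prop) fun x hx => by simp [hx]
  have hpt : ∀ x, -(P x * fderiv ℝ (fun x => φ x ^ 2) x e)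
      ≤ 2⁻¹ * φ x ^ 2 + 2 * R ^ 2 * ‖gradient φ x‖ ^ 2 := by
    intro x
    by_cases hx : x ∈ tsupport φ
    · have h1 : |P x| ≤ R := (PiLp.norm_apply_le x i).trans (hR x (hφD hx))
      have h2 : |fderiv ℝ φ x e| ≤ ‖gradient φ x‖ := by
        rw [← inner_gradient_left]
        refine (abs_real_inner_le_norm _ _).trans ?_
        simp [e]
      have h3 : (P x * fderiv ℝ φ x e) ^ 2 ≤ R ^ 2 * ‖gradient φ x‖ ^ 2 := by
        rw [mul_pow, ← sq_abs (P x), ← sq_abs (fderiv ℝ φ x e)]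
        gcongr
      rw [hsqd]
      nlinarith [sq_nonneg (φ x + 2 * (P x * fderiv ℝ φ x e))]
    · rw [hsqd, image_eq_zero_of_notMem_tsupport hx]
      simp only [mul_zero, zero_mul, neg_zero]
      positivity
  have hfinal := integral_mono (μ := (volume : Measure (Space d)))
    (f := fun x => -(P x * fderiv ℝ (fun x => φ x ^ 2) x e))
    (g := fun x => 2⁻¹ * φ x ^ 2 + 2 * R ^ 2 * ‖gradient φ x‖ ^ 2) ?_
    ((hIφ.const_mul _).add (hIg.const_mul _)) hpt
  · rw [integral_neg, hparts, integral_add (hIφ.const_mul _) (hIg.const_mul _),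
      integral_const_mul, integral_const_mul, neg_neg] at hfinal
    simp only [ContinuousLinearMap.fderiv, hPe, one_mul] at hfinal
    linarith
  · simp only [hsqd]
    exact hI (by fun_prop) fun x hx => by simp [hx]

/-- The pairs `(φ, ∇φ)` with `φ ∈ C_c^∞(D)`. -/
def smoothPairs (D : Set (Space d)) : Submodule ℝ (WithLp 2 (L2 D × L2Vec D)) where
  carrier := {w | ∃ φ : Space d → ℝ, ContDiff ℝ ∞ φ ∧ HasCompactSupport φ ∧ tsupport φ ⊆ D ∧
    w.fst =ᵐ[volume.restrict D] φ ∧ w.snd =ᵐ[volume.restrict D] gradient φ}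
  zero_mem' := by
    refine ⟨0, contDiff_const, HasCompactSupport.zero, by simp, ?_, ?_⟩
    · exact Lp.coeFn_zero _ _ _
    · have : gradient (0 : Space d → ℝ) = 0 := by
        ext1 x
        exact gradient_fun_const x 0
      rw [this]
      exact Lp.coeFn_zero _ _ _
  add_mem' := by
    rintro v w ⟨φ, hφ, hφc, hφD, hφv, hφg⟩ ⟨ψ, hψ, hψc, hψD, hψv, hψg⟩
    refine ⟨φ + ψ, hφ.add hψ, hφc.add hψc,
      (tsupport_add φ ψ).trans (Set.union_subset hφD hψD), ?_, ?_⟩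
    · exact (Lp.coeFn_add _ _).trans (hφv.add hψv)
    · have : gradient (φ + ψ) = gradient φ + gradient ψ := by
        ext1 x
        simp only [gradient, Pi.add_apply]
        rw [fderiv_add (hφ.differentiable (by simp) x) (hψ.differentiable (by simp) x), map_add]
      rw [this]
      exact (Lp.coeFn_add _ _).trans (hφg.add hψg)
  smul_mem' := by
    rintro c w ⟨φ, hφ, hφc, hφD, hφw, hφg⟩
    refine ⟨c • φ, hφ.const_smul c, hφc.smul_left,
      (tsupport_smul_subset_right (fun _ => c) φ).trans hφD, ?_, ?_⟩
    · exact (Lp.coeFn_smul _ _).trans (hφw.const_smul c)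
    · have : gradient (c • φ) = c • gradient φ := by
        ext1 x
        simp only [gradient, Pi.smul_apply]
        rw [fderiv_const_smul (hφ.differentiable (by simp) x), map_smulₛₗ]
        simp
      rw [this]
      exact (Lp.coeFn_smul _ _).trans (hφg.const_smul c)

/-- The smooth pairs already form a subspace, so closed conditions on `H10 D` need checking only on
single test functions. -/
theorem H10_eq_topologicalClosure_smoothPairs :
    H10 D = (smoothPairs D).topologicalClosure := by
  rw [H10, ← Submodule.span_eq (smoothPairs D)]
  rfl

theorem norm_Lp_two_sq {E : Type*} [NormedAddCommGroup E] [InnerProductSpace ℝ E]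
    (f : Lp E 2 (volume.restrict D)) : ‖f‖ ^ 2 = ∫ x in D, ‖f x‖ ^ 2 := by
  rw [← real_inner_self_eq_norm_sq, L2.inner_def]
  simp only [real_inner_self_eq_norm_sq]

/-- The **Poincaré inequality** on a bounded domain. -/
theorem H10.exists_norm_fn_le (hd : 0 < d) (hDb : Bornology.IsBounded D) :
    ∃ C : ℝ, 0 ≤ C ∧ ∀ v : H10 D, ‖H10.fn v‖ ≤ C * ‖H10.grad v‖ := by
  obtain ⟨R, hR⟩ := hDb.exists_norm_le
  refine ⟨2 * |R|, by positivity, fun v => ?_⟩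
  have hv : (v : WithLp 2 (L2 D × L2Vec D)) ∈ closure (smoothPairs D : Set _) := by
    rw [← Submodule.topologicalClosure_coe, ← H10_eq_topologicalClosure_smoothPairs]
    exact v.2
  have hclosed : IsClosed {w : WithLp 2 (L2 D × L2Vec D) | ‖w.fst‖ ≤ 2 * |R| * ‖w.snd‖} :=
    isClosed_le (WithLp.fstL 2 ℝ (L2 D) (L2Vec D)).continuous.norm
      (continuous_const.mul (WithLp.sndL 2 ℝ (L2 D) (L2Vec D)).continuous.norm)
  refine closure_minimal ?_ hclosed hv
  rintro w ⟨φ, hφ, hφc, hφD, hφw, hφg⟩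
  refine (sq_le_sq₀ (norm_nonneg _) (mul_nonneg (by positivity) (norm_nonneg _))).1 ?_
  have h1 : ‖w.fst‖ ^ 2 = ∫ x, φ x ^ 2 := by
    rw [norm_Lp_two_sq, ← setIntegral_eq_integral_of_forall_compl_eq_zero (s := D)
      (f := fun x => φ x ^ 2) fun x hx => by simp [image_eq_zero_of_notMem_tsupport fun h => hx (hφD h)]]
    exact integral_congr_ae (hφw.mono fun x hx => by simp [hx])
  have h2 : ‖w.snd‖ ^ 2 = ∫ x, ‖gradient φ x‖ ^ 2 := by
    rw [norm_Lp_two_sq, ← setIntegral_eq_integral_of_forall_compl_eq_zero (s := D)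
      (f := fun x => ‖gradient φ x‖ ^ 2) fun x hx => by
        simp [gradient_eq_zero_of_notMem_tsupport fun h => hx (hφD h)]]
    exact integral_congr_ae (hφg.mono fun x hx => by simp [hx])
  rw [mul_pow, h1, h2]
  exact integral_sq_le_integral_gradient_sq hd
    (fun x hx => (hR x hx).trans (le_abs_self R)) hφ hφc hφD

theorem H10.exists_norm_le (hd : 0 < d) (hDb : Bornology.IsBounded D) :
    ∃ C : ℝ, 0 < C ∧ ∀ v : H10 D, ‖v‖ ≤ C * ‖H10.grad v‖ := by
  obtain ⟨C, hC, h⟩ := H10.exists_norm_fn_le hd hDb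
  refine ⟨C + 1, by positivity, fun v => ?_⟩
  refine (sq_le_sq₀ (norm_nonneg _) (mul_nonneg (by positivity) (norm_nonneg _))).1 ?_
  have h1 : ‖v‖ ^ 2 = ‖H10.fn v‖ ^ 2 + ‖H10.grad v‖ ^ 2 :=
    WithLp.prod_norm_sq_eq_of_L2 (v : WithLp 2 (L2 D × L2Vec D))
  have h2 : ‖H10.fn v‖ ^ 2 ≤ (C * ‖H10.grad v‖) ^ 2 := by
    gcongr
    exact h v
  rw [h1]
  nlinarith [mul_nonneg hC (sq_nonneg ‖H10.grad v‖)]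

end Poincare

/-! ### The parametric diffusion problem -/

section Diffusion

variable {d M : ℕ} {D : Set (Space d)}

/-- Multiplication of vector fields by `b ∈ L^∞(D)`. -/
def mulL (b : LInf D) : L2Vec D →L[ℝ] L2Vec D :=
  LinearMap.mkContinuous
    { toFun := fun x => b • x
      map_add' := fun x z => Lp.add_smul b x z
      map_smul' := fun c x => (Lp.smul_comm c b x).symm } ‖b‖ fun x => Lp.norm_smul_le b x

theorem mulL_apply (b : LInf D) (x : L2Vec D) : mulL b x = b • x := rfl

/-- The weak gradient as a continuous linear map. -/
def gradL (D : Set (Space d)) : H10 D →L[ℝ] L2Vec D :=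
  (WithLp.sndL 2 ℝ (L2 D) (L2Vec D)).comp (H10 D).subtypeL

theorem gradL_apply (v : H10 D) : gradL D v = H10.grad v := rfl

/-- The flux as a continuous linear map. -/
def fluxL (b : LInf D) : H10 D →L[ℝ] L2Vec D := (mulL b).comp (gradL D)

theorem fluxL_apply (b : LInf D) (v : H10 D) : fluxL b v = flux b v := rfl

theorem mulL_add (b b' : LInf D) : mulL (b + b') = mulL b + mulL b' := by
  ext1 x
  exact Lp.smul_add b b' x

theorem mulL_smul (c : ℝ) (b : LInf D) : mulL (c • b) = c • mulL b := by
  ext1 x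
  exact Lp.smul_assoc c b x

theorem mulL_sum {ι : Type*} (s : Finset ι) (b : ι → LInf D) :
    mulL (∑ m ∈ s, b m) = ∑ m ∈ s, mulL (b m) := by
  classical
  induction s using Finset.induction_on with
  | empty =>
    ext1 x
    simp [mulL_apply]
  | insert m s hm ih => rw [Finset.sum_insert hm, Finset.sum_insert hm, mulL_add, ih]

theorem flux_coeff (a₀ : LInf D) (a : Fin M → LInf D) (y : Fin M → I) (v : H10 D) :
    flux (coeff a₀ a y) v = affineOp (fluxL a₀) (fun m => fluxL (a m)) y v := by
  rw [affineOp_apply, ← fluxL_apply, coeff, fluxL, mulL_add, mulL_sum]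
  simp [mulL_smul, fluxL]

theorem inner_mulL (b : LInf D) (x z : L2Vec D) :
    inner ℝ (mulL b x) z = ∫ t in D, b t * inner ℝ (x t) (z t) := by
  rw [L2.inner_def]
  refine integral_congr_ae ?_
  filter_upwards [Lp.coeFn_lpSMul (r := 2) b x] with t ht
  rw [mulL_apply, ht, Pi.smul_apply', real_inner_smul_left]

theorem integrable_mul_inner (b : LInf D) (x z : L2Vec D) :
    Integrable (fun t => b t * inner ℝ (x t) (z t)) (volume.restrict D) := by
  refine (L2.integrable_inner (𝕜 := ℝ) (mulL b x) z).congr ?_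
  filter_upwards [Lp.coeFn_lpSMul (r := 2) b x] with t ht
  rw [mulL_apply, ht, Pi.smul_apply', real_inner_smul_left]

theorem integrable_mul_norm_sq (b : LInf D) (x : L2Vec D) :
    Integrable (fun t => b t * ‖x t‖ ^ 2) (volume.restrict D) := by
  simpa only [real_inner_self_eq_norm_sq] using integrable_mul_inner b x x

theorem inner_mulL_self (b : LInf D) (x : L2Vec D) :
    inner ℝ (mulL b x) x = ∫ t in D, b t * ‖x t‖ ^ 2 := by
  simp only [inner_mulL, real_inner_self_eq_norm_sq]

theorem mul_norm_sq_le_inner_mulL_self {b : LInf D} {r : ℝ}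
    (hb : ∀ᵐ t ∂(volume.restrict D), r ≤ b t) (x : L2Vec D) :
    r * ‖x‖ ^ 2 ≤ inner ℝ (mulL b x) x := by
  rw [inner_mulL_self, norm_Lp_two_sq, ← integral_const_mul]
  refine integral_mono_ae ?_ (integrable_mul_norm_sq b x) ?_
  · refine Integrable.const_mul ?_ r
    simpa only [real_inner_self_eq_norm_sq] using L2.integrable_inner (𝕜 := ℝ) x x
  · filter_upwards [hb] with t ht
    exact mul_le_mul_of_nonneg_right ht (sq_nonneg _)

/-- Pointwise `2|x·z| ≤ |x|² + |z|²`. Comparing coefficients pointwise gives the contraction in the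
energy form of `b'`. -/
theorem two_mul_abs_inner_mulL_le {b b' : LInf D} {γ : ℝ}
    (hb : ∀ᵐ t ∂(volume.restrict D), |b t| ≤ γ * b' t) (x z : L2Vec D) :
    2 * |inner ℝ (mulL b x) z| ≤ γ * (inner ℝ (mulL b' x) x + inner ℝ (mulL b' z) z) := by
  rw [inner_mulL, inner_mulL_self, inner_mulL_self,
    ← integral_add (integrable_mul_norm_sq b' x) (integrable_mul_norm_sq b' z),
    ← integral_const_mul]
  refine (mul_le_mul_of_nonneg_left (abs_integral_le_integral_abs) zero_le_two).trans ?_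
  rw [← integral_const_mul]
  refine integral_mono_ae ((integrable_mul_inner b x z).abs.const_mul 2)
    (((integrable_mul_norm_sq b' x).add (integrable_mul_norm_sq b' z)).const_mul γ) ?_
  filter_upwards [hb] with t ht
  have h1 := abs_real_inner_le_norm (x t) (z t)
  have h2 : 2 * |(inner ℝ (x t) (z t) : ℝ)| ≤ ‖x t‖ ^ 2 + ‖z t‖ ^ 2 := by
    nlinarith [sq_nonneg (‖x t‖ - ‖z t‖)]
  calc 2 * |b t * inner ℝ (x t) (z t)| = |b t| * (2 * |inner ℝ (x t) (z t)|) := by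
        rw [abs_mul]; ring
    _ ≤ (γ * b' t) * (‖x t‖ ^ 2 + ‖z t‖ ^ 2) :=
        mul_le_mul ht h2 (by positivity) ((abs_nonneg _).trans ht)
    _ = _ := by ring

theorem ae_abs_le_norm (b : LInf D) : ∀ᵐ t ∂(volume.restrict D), |b t| ≤ ‖b‖ := by
  have h := ae_le_lpNorm_exponent_top (Lp.memLp b)
  rwa [← toReal_eLpNorm (Lp.memLp b).aestronglyMeasurable, ← Lp.norm_def] at h

theorem coeFn_sum_coord_smul (a : Fin M → LInf D) (y : Fin M → I) :
    ∀ᵐ t ∂(volume.restrict D), (∑ m, (y m : ℝ) • a m : LInf D) t = ∑ m, (y m : ℝ) * a m t := by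
  have h : ∀ᵐ t ∂(volume.restrict D), ∀ m, ((y m : ℝ) • a m : LInf D) t = (y m : ℝ) * a m t :=
    ae_all_iff.2 fun m => Lp.coeFn_smul (y m : ℝ) (a m)
  filter_upwards [h, Lp.coeFn_finsetSum Finset.univ fun m => (y m : ℝ) • a m] with t h1 h2
  rw [h2, Finset.sum_apply]
  exact Finset.sum_congr rfl fun m _ => h1 m

theorem abs_sum_coord_mul_le (y : Fin M → I) (b : Fin M → ℝ) :
    |∑ m, (y m : ℝ) * b m| ≤ ∑ m, |b m| :=
  (Finset.abs_sum_le_sum_abs _ _).trans (Finset.sum_le_sum fun m _ => by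
    rw [abs_mul]
    exact mul_le_of_le_one_left (abs_nonneg _) (abs_le.2 (y m).2))

theorem UniformlyElliptic.le_coeff {a₀ : LInf D} {a : Fin M → LInf D} {r : ℝ}
    (ha : UniformlyElliptic a₀ a r) (y : Fin M → I) :
    ∀ᵐ t ∂(volume.restrict D), r ≤ coeff a₀ a y t := by
  filter_upwards [ha, Lp.coeFn_add a₀ (∑ m, (y m : ℝ) • a m), coeFn_sum_coord_smul a y]
    with t ht h1 h2
  rw [coeff, h1, Pi.add_apply, h2]
  have := abs_sum_coord_mul_le y fun m => a m t
  linarith [neg_abs_le (∑ m, (y m : ℝ) * a m t)]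

theorem UniformlyElliptic.exists_abs_le {a₀ : LInf D} {a : Fin M → LInf D} {r : ℝ}
    (hr : 0 < r) (ha : UniformlyElliptic a₀ a r) :
    ∃ γ : ℝ, 0 ≤ γ ∧ γ < 1 ∧ ∀ y : Fin M → I, ∀ᵐ t ∂(volume.restrict D),
      |(∑ m, (y m : ℝ) • a m : LInf D) t| ≤ γ * a₀ t := by
  have hN : 0 < ‖a₀‖ + r := by positivity
  -- With this `γ`, `(1 - γ) a₀ = r a₀ / (‖a₀‖ + r) ≤ r`, that is, `a₀ - r ≤ γ a₀`.
  refine ⟨‖a₀‖ / (‖a₀‖ + r), by positivity, (div_lt_one hN).2 (by linarith), fun y => ?_⟩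
  filter_upwards [ha, ae_abs_le_norm a₀, coeFn_sum_coord_smul a y] with t ht h1 h2
  rw [h2]
  refine (abs_sum_coord_mul_le y fun m => a m t).trans (ht.trans ?_)
  rw [div_mul_eq_mul_div, le_div_iff₀ hN]
  nlinarith [le_abs_self (a₀ t)]

end Diffusion

/-! ### Lax–Milgram and the Neumann series in the parameter -/

section Diffusion

variable {d M : ℕ} {D : Set (Space d)}

instance : CompleteSpace (H10 D) :=
  (Submodule.isClosed_topologicalClosure _).completeSpace_coe

/-- The elliptic operator `H¹₀(D) → H¹₀(D)` representing the form `∫ b ∇v · ∇w`. -/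
def formL (b : LInf D) : H10 D →L[ℝ] H10 D :=
  (ContinuousLinearMap.adjoint (gradL D)).comp (fluxL b)

theorem inner_formL (b : LInf D) (v w : H10 D) :
    inner ℝ (formL b v) w = inner ℝ (flux b v) (H10.grad w) := by
  rw [formL, ContinuousLinearMap.comp_apply, ContinuousLinearMap.adjoint_inner_left, fluxL_apply,
    gradL_apply]

theorem inner_formL_sum_coord_smul (a : Fin M → LInf D) (y : Fin M → I) (v w : H10 D) :
    inner ℝ (∑ m, (y m : ℝ) • formL (a m) v) w
      = inner ℝ (flux (∑ m, (y m : ℝ) • a m) v) (H10.grad w) := by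
  rw [← inner_formL]
  congr 1
  simp [formL, fluxL, mulL_sum, mulL_smul]

theorem formL_coeff (a₀ : LInf D) (a : Fin M → LInf D) (y : Fin M → I) (v : H10 D) :
    formL (coeff a₀ a y) v = formL a₀ v + ∑ m, (y m : ℝ) • formL (a m) v := by
  refine ext_inner_right ℝ fun w => ?_
  rw [inner_add_left, inner_formL_sum_coord_smul, inner_formL, inner_formL, ← inner_add_left]
  congr 1
  exact Lp.smul_add _ _ _

theorem isWeakSolution_iff {b : LInf D} {f : L2 D} {v : H10 D} :
    IsWeakSolution b f v ↔ ∀ w, inner ℝ (formL b v) w = inner ℝ f (H10.fn w) := by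
  simp only [IsWeakSolution, inner_formL]

/-- Coercivity of the diffusion form. -/
theorem exists_mul_norm_sq_le_inner_formL (hd : 0 < d) (hDb : Bornology.IsBounded D) {r : ℝ}
    (hr : 0 < r) : ∃ s : ℝ, 0 < s ∧ ∀ b : LInf D, (∀ᵐ t ∂(volume.restrict D), r ≤ b t) →
      ∀ v : H10 D, s * ‖v‖ ^ 2 ≤ inner ℝ (formL b v) v := by
  obtain ⟨C, hC, h⟩ := H10.exists_norm_le hd hDb
  refine ⟨r / C ^ 2, by positivity, fun b hb v => ?_⟩
  rw [inner_formL]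
  refine le_trans ?_ (mul_norm_sq_le_inner_mulL_self hb (H10.grad v))
  rw [div_mul_eq_mul_div, div_le_iff₀ (by positivity), mul_assoc, mul_comm _ (C ^ 2), ← mul_pow]
  have := h v
  gcongr

theorem IsWeakSolution.unique (hd : 0 < d) (hDb : Bornology.IsBounded D) {r : ℝ} (hr : 0 < r)
    {b : LInf D} (hb : ∀ᵐ t ∂(volume.restrict D), r ≤ b t) {f : L2 D} {v w : H10 D}
    (hv : IsWeakSolution b f v) (hw : IsWeakSolution b f w) : v = w := by
  obtain ⟨s, hs, h⟩ := exists_mul_norm_sq_le_inner_formL hd hDb hr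
  rw [isWeakSolution_iff] at hv hw
  have h0 : inner ℝ (formL b (v - w)) (v - w) = 0 := by
    rw [map_sub, inner_sub_left, hv, hw, sub_self]
  have h1 := h b hb (v - w)
  rw [h0] at h1
  have h2 : ‖v - w‖ ^ 2 ≤ 0 := nonpos_of_mul_nonpos_right h1 hs
  exact sub_eq_zero.1 (norm_eq_zero.1 (pow_eq_zero_iff two_ne_zero |>.1
    (le_antisymm h2 (sq_nonneg _))))

theorem exists_formL_equiv (hd : 0 < d) (hDb : Bornology.IsBounded D) {r : ℝ} (hr : 0 < r)
    {b : LInf D} (hb : ∀ᵐ t ∂(volume.restrict D), r ≤ b t) :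
    ∃ E : H10 D ≃L[ℝ] H10 D, ∀ v, E v = formL b v := by
  obtain ⟨s, hs, h⟩ := exists_mul_norm_sq_le_inner_formL hd hDb hr
  let B : H10 D →L[ℝ] H10 D →L[ℝ] ℝ := (innerSL ℝ).comp (formL b)
  have hB : IsCoercive B := ⟨s, hs, fun v => by
    simpa [B, sq, mul_assoc] using h b hb v⟩
  refine ⟨hB.continuousLinearEquivOfBilin, fun v => ext_inner_right ℝ fun w => ?_⟩
  rw [hB.continuousLinearEquivOfBilin_apply]
  rfl

/-- The solution of the parametric diffusion problem is a geometrically convergent series of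
polynomials in the parameter. -/
theorem exists_polynomial_expansion (hd : 0 < d) (hDb : Bornology.IsBounded D)
    {a₀ : LInf D} {a : Fin M → LInf D} {f : L2 D} {r : ℝ} (hr : 0 < r)
    (ha : UniformlyElliptic a₀ a r) {u : (Fin M → I) → H10 D}
    (hu : ∀ y, IsWeakSolution (coeff a₀ a y) f (u y)) :
    ∃ (v : ℕ → (Fin M → I) → H10 D) (C q : ℝ), 0 ≤ q ∧ q < 1 ∧
      (∀ n, v n ∈ polySpan {ν | ∑ m, ν m ≤ n} (H10 D)) ∧ (∀ n y, ‖v n y‖ ≤ C * q ^ n) ∧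
      ∀ y, HasSum (fun n => v n y) (u y) := by
  obtain ⟨γ, hγ0, hγ1, hγ⟩ := ha.exists_abs_le hr
  have ha₀ : ∀ᵐ t ∂(volume.restrict D), r ≤ a₀ t := by
    filter_upwards [ha] with t ht
    have : 0 ≤ ∑ m, |a m t| := Finset.sum_nonneg fun _ _ => abs_nonneg _
    linarith
  obtain ⟨s, hs, hcoer⟩ := exists_mul_norm_sq_le_inner_formL hd hDb hr
  obtain ⟨E, hE⟩ := exists_formL_equiv hd hDb hr ha₀
  let z : Fin M → I := fun _ => ⟨0, by norm_num⟩
  -- With `A₀`, `A_m` the operators of `a₀`, `a_m`, these are the Neumann terms: `v₀ = u(0)` and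
  -- `v_{n+1} = -A₀⁻¹ ∑ y_m A_m v_n`.
  let v : ℕ → (Fin M → I) → H10 D := fun n => n.rec (fun _ => u z)
    fun _ w y => ∑ m, (y m : ℝ) • (-E.symm (formL (a m) (w y)))
  have hrec : ∀ n y, formL a₀ (v (n + 1) y) = -∑ m, (y m : ℝ) • formL (a m) (v n y) := fun n y => by
    rw [← hE]
    change E (∑ m, (y m : ℝ) • (-E.symm (formL (a m) (v n y)))) = _
    simp
  set Q : H10 D → ℝ := fun w => inner ℝ (formL a₀ w) w with hQ
  -- Testing the recursion with `v_{n+1}` gives `2 Q_{n+1} ≤ γ (Q_n + Q_{n+1})`; then use `2 - γ ≥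
  -- 1` and `Q_{n+1} ≥ 0`. As `Q` is quadratic, norms decay with ratio `√γ`.
  have hQstep : ∀ n y, Q (v (n + 1) y) ≤ γ * Q (v n y) := fun n y => by
    have h1 : Q (v (n + 1) y)
        = -inner ℝ (mulL (∑ m, (y m : ℝ) • a m) (H10.grad (v n y))) (H10.grad (v (n + 1) y)) := by
      simp only [hQ]
      rw [hrec, inner_neg_left, inner_formL_sum_coord_smul]
      rfl
    have h2 := two_mul_abs_inner_mulL_le (hγ y) (H10.grad (v n y)) (H10.grad (v (n + 1) y))
    have h3 : ∀ w : H10 D, inner ℝ (mulL a₀ (H10.grad w)) (H10.grad w) = Q w := fun w =>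
      (inner_formL a₀ w w).symm
    rw [h3, h3] at h2
    have h4 : 0 ≤ Q (v (n + 1) y) :=
      (mul_nonneg hs.le (sq_nonneg _)).trans (hcoer a₀ ha₀ (v (n + 1) y))
    have h5 := h1.trans_le (neg_le_abs _)
    nlinarith
  have hQn : ∀ n y, Q (v n y) ≤ Q (u z) * γ ^ n := fun n y => by
    induction n with
    | zero => simp [v]
    | succ n ih =>
      refine (hQstep n y).trans ?_
      rw [pow_succ]
      nlinarith
  have hbound : ∀ n y, ‖v n y‖ ≤ √(Q (u z) / s) * √γ ^ n := fun n y => by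
    have hQ0 : 0 ≤ Q (u z) := (mul_nonneg hs.le (sq_nonneg _)).trans (hcoer a₀ ha₀ (u z))
    refine (sq_le_sq₀ (norm_nonneg _) (by positivity)).1 ?_
    rw [mul_pow, ← pow_mul, mul_comm n 2, pow_mul, Real.sq_sqrt (by positivity), Real.sq_sqrt hγ0,
      div_mul_eq_mul_div, le_div_iff₀ hs, mul_comm]
    exact (hcoer a₀ ha₀ (v n y)).trans (hQn n y)
  have hγ1' : √γ < 1 := by
    rw [Real.sqrt_lt' one_pos]
    simpa using hγ1
  refine ⟨v, √(Q (u z) / s), √γ, Real.sqrt_nonneg _, hγ1', fun n => ?_, hbound, fun y => ?_⟩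
  · induction n with
    | zero => exact const_mem_polySpan (by simp) (u z)
    | succ n ih =>
      have : v (n + 1) = ∑ m, fun y => (y m : ℝ) • (-E.symm (formL (a m) (v n y))) := by
        ext1 y
        rw [Finset.sum_apply]
      rw [this]
      refine Submodule.sum_mem _ fun m _ => coord_smul_mem_polySpan m (fun ν hν => ?_)
        (map_mem_polySpan (-((E.symm : H10 D →L[ℝ] H10 D).comp (formL (a m)))).toLinearMap ih)
      simp only [Set.mem_ofPred_eq, Pi.add_apply, Finset.sum_add_distrib] at hν ⊢
      rw [Finset.sum_pi_single' m 1]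
      simpa using hν
  · have hsum : Summable fun n => v n y := Summable.of_norm_bounded
      ((summable_geometric_of_lt_one (Real.sqrt_nonneg _) hγ1').mul_left _) fun n => hbound n y
    suffices h : ∑' n, v n y = u y by
      rw [← h]
      exact hsum.hasSum
    -- By uniqueness it suffices that the sum solves the equation. Summing the recursion shows that
    -- `A₀ ∑ v_n - A₀ v₀` equals `-(∑ y_m A_m) ∑ v_n`.
    refine IsWeakSolution.unique hd hDb hr (ha.le_coeff y) (isWeakSolution_iff.2 fun w => ?_) (hu y)
    have hz : formL (coeff a₀ a z) (u z) = formL a₀ (u z) := by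
      rw [formL_coeff]
      simp [z]
    rw [← isWeakSolution_iff.1 (hu z) w, hz]
    congr 1
    have h1 := (formL a₀).hasSum hsum.hasSum
    have h2 := (∑ m, (y m : ℝ) • formL (a m)).hasSum hsum.hasSum
    have h3 := (hasSum_nat_add_iff' 1).2 h1
    have h4 : HasSum (fun n => formL a₀ (v (n + 1) y))
        (-(∑ m, (y m : ℝ) • formL (a m)) (∑' n, v n y)) := by
      refine h2.neg.congr_fun fun n => ?_
      rw [hrec]
      simp
    have h5 := h3.unique h4
    rw [formL_coeff]
    simp only [Finset.range_one, Finset.sum_singleton, _root_.sum_apply, _root_.smul_apply] at h5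
    rw [eq_neg_iff_add_eq_zero] at h5
    rw [← sub_eq_zero, ← h5]
    change _ = formL a₀ _ - formL a₀ (u z) + _
    abel

end Diffusion

end SparseColl

end

theorem theorem4p2
    {d M : ℕ} (hd : 0 < d) (hM : 0 < M)
    (D : Set (SparseColl.Space d)) (hD : IsOpen D) (hDb : Bornology.IsBounded D)
    (a₀ : SparseColl.LInf D) (a : Fin M → SparseColl.LInf D) (f : SparseColl.L2 D)
    (r : ℝ) (hr : 0 < r) (ha : SparseColl.UniformlyElliptic a₀ a r)
    (u : (Fin M → SparseColl.I) → SparseColl.H10 D)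
    (hu : ∀ y, SparseColl.IsWeakSolution (SparseColl.coeff a₀ a y) f (u y))
    (node : ℕ → SparseColl.I) (hnode : Function.Injective node)
    (g : ℕ → ℕ) (hg0 : g 0 = 0) (hg : StrictMono g)
    (c θ : ℝ) (hc : 0 ≤ c) (hθ : 0 ≤ θ)
    (hΔ : ∀ k : ℕ, ‖SparseColl.detail node g k‖ ≤ (1 + c * (k : ℝ)) ^ θ)
    (p : ℝ≥0∞) (hp : 1 ≤ p)
    (Λ : ℕ → Finset (Fin M → ℕ))
    (hΛ : SparseColl.IsAdaptiveRun a₀ a node g p u Λ) :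
    MemLp u p (SparseColl.unif M) ∧
    (∀ n, MemLp (SparseColl.sparse node g (Λ n) u) p (SparseColl.unif M)) ∧
    Tendsto (fun n => eLpNorm (u - SparseColl.sparse node g (Λ n) u) p (SparseColl.unif M))
      atTop (𝓝 0) := by
  obtain ⟨v, C, q, hq0, hq1, hv, hvC, hvu⟩ :=
    SparseColl.exists_polynomial_expansion hd hDb hr ha hu
  obtain ⟨δ, hδ0, hδ, huδ, husum⟩ := SparseColl.exists_summable_bound_tensorDetail hnode hg hc hθ hΔ
    hq0 hq1 hv hvC hvu
  -- The abstract theorem tests the flux itself, not its image in `H10 D`, since the estimator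
  -- measures `Δ_k` of the flux; the test functionals are pairings with `∇w`.
  have hT : ∀ y z, SparseColl.IsWeakSolution (SparseColl.coeff a₀ a y) f z ↔
      ∀ w : SparseColl.H10 D, innerSL ℝ (SparseColl.H10.grad w)
        (SparseColl.affineOp (SparseColl.fluxL a₀) (fun m => SparseColl.fluxL (a m)) y z)
        = inner ℝ f (SparseColl.H10.fn w) := fun y z => by
    simp only [SparseColl.IsWeakSolution, innerSL_apply_apply, SparseColl.flux_coeff,
      real_inner_comm]
  refine SparseColl.tendsto_eLpNorm_sub_sparse hnode hg hc hθ hΔ (SparseColl.fluxL a₀)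
    (fun m => SparseColl.fluxL (a m)) (fun w : SparseColl.H10 D => innerSL ℝ (SparseColl.H10.grad w))
    (fun w => inner ℝ f (SparseColl.H10.fn w)) (fun y => (hT y _).1 (hu y))
    (fun y z hz => ((hT y z).2 hz).unique hd hDb hr (ha.le_coeff y) (hu y))
    hδ0 hδ huδ husum hp hΛ.init fun n => ?_
  simpa only [SparseColl.estimator, SparseColl.flux_coeff] using hΛ.step n
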